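/- For $\nu>0$, $\nu\neq\frac12$, let $v_\nu(x)=\dfrac{x}{(1+x^2)^{\nu}}$ for $x\in\mathbb R$, and \[ \tilde V_\nu(x)= \begin{cases} -\dfrac{2(1-2\nu)\,\Gamma(\nu-\frac12)}{(1-\nu)\sqrt{\pi}\,\Gamma(\nu-1)}\,(1+x^2)^{\nu}\,{}_2F_1\!\left(2,\tfrac12+\nu;\tfrac32;-x^2\right), & \nu\neq1,\\[2mm] -\dfrac{2}{1+x^2}, & \nu=1, \end{cases} \] where ${}_2F_1(a,b;c;\cdot)$ denotes the analytic continuation to $(-\infty,1)$ of the Gauss hypergeometric series. Let $\sqrt{-d^2/dx^2}$ be the Fourier multiplier with symbol $|k|$. Then \[ \sqrt{-\tfrac{d^2}{dx^2}}\,v_\nu+\tilde V_\nu v_\nu=0 \] in the sense of distributions, that is, $\int_{\mathbb R} v_\nu\,\sqrt{-d^2/dx^2}\,\varphi\,dx+\int_{\mathbb R}\tilde V_\nu v_\nu\,\varphi\,dx=0$, with both integrals absolutely convergent, for every Schwartz function $\varphi$. The function $v_\nu$ is odd. If $\nu>\frac34$, then $v_\nu$ is an eigenfunction of $\sqrt{-d^2/dx^2}+\tilde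 V_\nu$ on $L^2(\mathbb R)$ with eigenvalue $0$: it is a nonzero element of $L^2(\mathbb R)$ in the domain of $\sqrt{-d^2/dx^2}$, $\tilde V_\nu v_\nu\in L^2(\mathbb R)$, and the equation holds in $L^2(\mathbb R)$. If $\frac12<\nu\le\frac34$, then $v_\nu$ is a zero-resonance: it is a distributional solution that tends to $0$ at infinity but does not belong to $L^2(\mathbb R)$. Moreover, as $|x|\to\infty$, \[ \tilde V_\nu(x)= \begin{cases} O(1/|x|), & \frac12<\nu<\frac32,\ \nu\neq1,\\ O(1/|x|^{2}), & \nu=1,\\ O(\log|x|/|x|), & \nu=\frac32,\\ O(1/|x|^{4-2\nu}), & \frac32<\nu<2. \end{cases} \] -/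

import Mathlib

open MeasureTheory Filter Topology Asymptotics
open scoped FourierTransform SchwartzMap

/-- `F` is the analytic continuation of the Gauss hypergeometric series
`∑ (a)ₙ (b)ₙ / ((c)ₙ n!) zⁿ` from the interval `(-1, 1)` to the half-line `(-∞, 1)`. -/
def IsHypergeometricContinuation (a b c : ℝ) (F : ℝ → ℝ) : Prop :=
  AnalyticOnNhd ℝ F (Set.Iio 1) ∧
    ∀ z ∈ Set.Ioo (-1 : ℝ) 1, F z = ordinaryHypergeometric a b c z

/-- The analytic continuation to `(-∞, 1)` is unique. -/
theorem IsHypergeometricContinuation.eqOn {a b c : ℝ} {F G : ℝ → ℝ}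
    (hF : IsHypergeometricContinuation a b c F) (hG : IsHypergeometricContinuation a b c G) :
    Set.EqOn F G (Set.Iio 1) := by
  refine hF.1.eqOn_of_preconnected_of_eventuallyEq hG.1 isPreconnected_Iio
    (show (0 : ℝ) ∈ Set.Iio 1 by norm_num) ?_
  filter_upwards [Ioo_mem_nhds (show (-1 : ℝ) < 0 by norm_num) (show (0 : ℝ) < 1 by norm_num)]
    with z hz
  rw [hF.2 z hz, hG.2 z hz]

open Classical in
/-- The hypergeometric function `₂F₁(a, b; c; z)` for real `z < 1`: the analytic continuation of
the Gauss series. (It exists whenever `c` is not a non-positive integer; the value `0` is used for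
the other parameters.) Mathlib's `ordinaryHypergeometric` is only the sum of the series, which
diverges for `z < -1`. -/
noncomputable def hypergeometric (a b c z : ℝ) : ℝ :=
  if h : ∃ F : ℝ → ℝ, IsHypergeometricContinuation a b c F then h.choose z else 0

/-- The potential `Ṽ_ν`. -/
noncomputable def potential (ν x : ℝ) : ℝ :=
  if ν = 1 then -2 / (1 + x ^ 2)
  else
    -(2 * (1 - 2 * ν) * Real.Gamma (ν - 1 / 2)) /
        ((1 - ν) * Real.sqrt Real.pi * Real.Gamma (ν - 1)) *
      (1 + x ^ 2) ^ ν * hypergeometric 2 (1 / 2 + ν) (3 / 2) (-x ^ 2)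

/-- The function `v_ν(x) = x / (1 + x²)^ν`. -/
noncomputable def zeroMode (ν x : ℝ) : ℝ := x / (1 + x ^ 2) ^ ν

/-- `√(-d²/dx²) φ` for a Schwartz function `φ`: multiplication by `|k|` on the Fourier side. With
Mathlib's Fourier transform `∫ e^{-2πixξ} φ(x) dx`, the momentum is `k = 2πξ`. -/
noncomputable def sqrtLaplacian (φ : 𝓢(ℝ, ℂ)) : ℝ → ℂ :=
  𝓕⁻ (fun ξ : ℝ => ((2 * Real.pi * |ξ| : ℝ) : ℂ) * 𝓕 (φ : ℝ → ℂ) ξ)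

/-- `√(-d²/dx²) v + V v = 0` in the sense of (tempered) distributions: for every test function `φ`,
`∫ v √(-d²/dx²)φ + ∫ V v φ = 0`, where both integrals converge absolutely. -/
def IsDistributionalZeroSolution (V v : ℝ → ℝ) : Prop :=
  ∀ φ : 𝓢(ℝ, ℂ),
    Integrable (fun x : ℝ => (v x : ℂ) * sqrtLaplacian φ x) ∧
    Integrable (fun x : ℝ => ((V x * v x : ℝ) : ℂ) * φ x) ∧
    (∫ x : ℝ, (v x : ℂ) * sqrtLaplacian φ x) + (∫ x : ℝ, ((V x * v x : ℝ) : ℂ) * φ x) = 0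

/-- `v` is an eigenfunction of `H = √(-d²/dx²) + V` on `L²(ℝ)` with eigenvalue `0`: the class `f` of
`v` is a nonzero element of `L²(ℝ)` in the domain of the self-adjoint operator `√(-d²/dx²)`, with
`g = √(-d²/dx²) f ∈ L²(ℝ)`, and `g + V v = 0` (so that also `V v ∈ L²(ℝ)`). -/
def IsZeroEigenfunction (V v : ℝ → ℝ) : Prop :=
  ∃ f g : Lp ℂ 2 (volume : Measure ℝ),
    f ≠ 0 ∧
    (∀ᵐ x : ℝ, f x = (v x : ℂ)) ∧
    (∀ᵐ ξ : ℝ, (𝓕 g : Lp ℂ 2 (volume : Measure ℝ)) ξ =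
      ((2 * Real.pi * |ξ| : ℝ) : ℂ) * (𝓕 f : Lp ℂ 2 (volume : Measure ℝ)) ξ) ∧
    (∀ᵐ x : ℝ, g x + ((V x * v x : ℝ) : ℂ) = 0)

/-- `v` is a zero-resonance of `H = √(-d²/dx²) + V`: a distributional solution of `H v = 0` that
vanishes at infinity but is not square integrable. -/
def IsZeroResonance (V v : ℝ → ℝ) : Prop :=
  IsDistributionalZeroSolution V v ∧ Tendsto v (cocompact ℝ) (𝓝 0) ∧ ¬ MemLp v 2 volume

/-! The mode is a superposition of odd Gaussians: `Γ(ν) v_ν(x) = ∫₀^∞ t^(ν-1) e^(-t) · x e^(-t x²)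
dt`. On a single odd Gaussian the multiplier `|k|` is explicit: its Fourier transform is again an
odd Gaussian, and after multiplication by `|ξ|` only a half-line sine moment of a Gaussian survives.
That moment solves a first-order linear ODE, and the outcome is `(4/√π) √t x K(t x²)`, where `K(w) =
∫₀¹ (1 - w s) e^(-w s) dr` with `s = 1 - r²` is `₁F₁(2; 3/2; -w)`
(`fourier_abs_mul_fourier_oddGaussian`).

The factor `√t` shifts the Gamma weight from `ν` to `ν + 1/2`, and integration in `t` turns `₁F₁(2;
3/2; ·)` into `Γ(ν + 1/2) ₂F₁(2, ν + 1/2; 3/2; -x²)` (`integral_rpow_mul_exp_mul_kummerIntegral`).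
Hence `√(-d²/dx²) v_ν` is `4 Γ(ν + 1/2) / (√π Γ(ν))` times `x ₂F₁`, which is `-Ṽ_ν v_ν` by the Gamma
recurrences (`potential_eq`). The computation is carried out against a Schwartz function; Fubini is
justified by the decay `O(1/(1 + x²))` of `√(-d²/dx²) φ`.

The continued `₂F₁` is handled through one integral, `hyperIntegral`, valid for all `z < 1`. An
integration by parts exposes a factor `1 - r²` in it, and this gives the sharp decay as `z → -∞`,
hence the bounds on the potential.

For `ν > 3/4` both `v_ν` and `Ṽ_ν v_ν` are in `L²`. The distributional identity, tested on functions
whose Fourier side avoids the corner of `|ξ|` at `0`, then becomes the identity of Fourier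
transforms. -/

/-! ### Integral representation of `₂F₁(2, b; 3/2; z)` for `z < 1`. -/

/-- The integrand of the integral representation of `₂F₁(2, b; 3/2; ·)`. -/
noncomputable def hyperKernel (b y : ℝ) : ℝ :=
  b * (1 - y) ^ (-(b + 1)) - (b - 1) * (1 - y) ^ (-b)

/-- The integral `∫₀¹ hyperKernel b (z (1 - r²)) dr`, which represents `₂F₁(2, b; 3/2; z)`. -/
noncomputable def hyperIntegral (b z : ℝ) : ℝ :=
  ∫ r in (0 : ℝ)..1, hyperKernel b (z * (1 - r ^ 2))

theorem ringChoose_eq_ascPochhammer_div (a : ℝ) (n : ℕ) :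
    Ring.choose (a + n - 1) n = (ascPochhammer ℝ n).eval a / n.factorial := by
  rw [Ring.choose, show a + n - 1 - n + 1 = a by ring, eq_div_iff (by positivity), mul_comm,
    ← nsmul_eq_mul, Ring.factorial_nsmul_multichoose_eq_ascPochhammer,
    Polynomial.ascPochhammer_smeval_eq_eval]

theorem hasSum_one_sub_rpow_neg (a : ℝ) {y : ℝ} (hy : |y| < 1) :
    HasSum (fun n : ℕ => (ascPochhammer ℝ n).eval a / n.factorial * y ^ n) ((1 - y) ^ (-a)) := by
  have h := (Real.one_div_one_sub_rpow_hasFPowerSeriesOnBall_zero a).hasSum (y := y)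
    (by simpa [enorm_eq_nnnorm, ← NNReal.coe_lt_coe] using hy)
  simp only [FormalMultilinearSeries.ofScalars_apply_eq, ringChoose_eq_ascPochhammer_div,
    zero_add, smul_eq_mul] at h
  rwa [one_div, ← Real.rpow_neg (by linarith [abs_lt.1 hy])] at h

theorem mul_ascPochhammer_eval_add_one (b : ℝ) (n : ℕ) :
    b * (ascPochhammer ℝ n).eval (b + 1) = (ascPochhammer ℝ n).eval b * (b + n) := by
  rw [← ascPochhammer_succ_eval, ascPochhammer_succ_left]
  simp

theorem ascPochhammer_eval_two (n : ℕ) :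
    (ascPochhammer ℝ n).eval 2 = (n + 1) * n.factorial := by
  have h := mul_ascPochhammer_eval_add_one 1 n
  rw [ascPochhammer_eval_one] at h
  norm_num at h
  rw [h]; ring

/-- Since `b (b+1)ₙ = (b)ₙ (b + n)`, the two binomial series combine with coefficient `(b + n) - (b
- 1) = n + 1`. The kernel is therefore `₂F₁(2, b; 1; y)`. -/
theorem hasSum_hyperKernel (b : ℝ) {y : ℝ} (hy : |y| < 1) :
    HasSum (fun n : ℕ => (n + 1) * ((ascPochhammer ℝ n).eval b / n.factorial) * y ^ n)
      (hyperKernel b y) := by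
  rw [hyperKernel]
  convert! ((hasSum_one_sub_rpow_neg (b + 1) hy).mul_left b).sub
    ((hasSum_one_sub_rpow_neg b hy).mul_left (b - 1)) using 2 with n
  have := mul_ascPochhammer_eval_add_one b n
  field_simp
  linear_combination (-y ^ n) * this

/-- These Beta values are `(1)ₙ / (3/2)ₙ`, so averaging over `r` raises the lower parameter of the
series from `1` to `3/2`. The recursion in `n` comes from the derivative of `r (1 - r²)^(n+1)`,
which vanishes at both ends. -/
theorem integral_one_sub_sq_pow (n : ℕ) :
    ∫ r in (0 : ℝ)..1, (1 - r ^ 2) ^ n = n.factorial / (ascPochhammer ℝ n).eval (3 / 2) := by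
  have hpos : ∀ n, 0 < (ascPochhammer ℝ n).eval (3 / 2) := fun n => ascPochhammer_pos n _ (by norm_num)
  induction n with
  | zero => simp
  | succ n ih =>
    have h : ∫ r in (0 : ℝ)..1, ((2 * n + 3) * (1 - r ^ 2) ^ (n + 1)
        - 2 * (n + 1) * (1 - r ^ 2) ^ n) = 1 * (1 - 1 ^ 2) ^ (n + 1) - 0 * (1 - 0 ^ 2) ^ (n + 1) := by
      refine intervalIntegral.integral_eq_sub_of_hasDerivAt
        (f := fun r : ℝ => r * (1 - r ^ 2) ^ (n + 1)) (fun r _ => ?_)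
        (Continuous.intervalIntegrable (by fun_prop) _ _)
      convert! (hasDerivAt_id r).mul ((((hasDerivAt_id r).pow 2).const_sub 1).pow (n + 1)) using 1
      simp
      ring
    rw [intervalIntegral.integral_sub (Continuous.intervalIntegrable (by fun_prop) _ _)
      (Continuous.intervalIntegrable (by fun_prop) _ _), intervalIntegral.integral_const_mul,
      intervalIntegral.integral_const_mul, ih] at h
    simp at h
    rw [ascPochhammer_succ_eval, Nat.factorial_succ, eq_div_iff (by have := hpos n; positivity)]
    have := hpos n
    field_simp at h
    push_cast
    linarith

theorem abs_mul_one_sub_sq_le {z r : ℝ} (hr : r ∈ Set.uIoc (0 : ℝ) 1) :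
    |z * (1 - r ^ 2)| ≤ |z| := by
  rw [Set.uIoc_of_le zero_le_one] at hr
  rw [abs_mul]
  refine mul_le_of_le_one_right (abs_nonneg z) (abs_le.2 ⟨?_, ?_⟩) <;> nlinarith [hr.1, hr.2]

theorem hyperIntegral_eq_ordinaryHypergeometric {b z : ℝ} (hz : |z| < 1) :
    hyperIntegral b z = ordinaryHypergeometric 2 b (3 / 2) z := by
  rw [ordinaryHypergeometric_eq_tsum]
  have hsum := (hasSum_hyperKernel b (y := |z|) (by simpa using hz)).summable.abs
  have key := intervalIntegral.hasSum_integral_of_dominated_convergence (μ := volume)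
    (a := (0 : ℝ)) (b := 1)
    (F := fun (n : ℕ) r => (n + 1) * ((ascPochhammer ℝ n).eval b / n.factorial) *
      (z * (1 - r ^ 2)) ^ n) (f := fun r => hyperKernel b (z * (1 - r ^ 2)))
    (fun n _ => |(n + 1) * ((ascPochhammer ℝ n).eval b / n.factorial) * |z| ^ n|)
    (fun n => (Continuous.aestronglyMeasurable (by fun_prop)))
    (fun n => Eventually.of_forall fun r hr => by
      rw [Real.norm_eq_abs, abs_mul, abs_mul _ (|z| ^ n), abs_pow, abs_pow, abs_abs]
      exact mul_le_mul_of_nonneg_left (pow_le_pow_left₀ (abs_nonneg _)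
        (abs_mul_one_sub_sq_le hr) n) (abs_nonneg _))
    (Eventually.of_forall fun _ _ => hsum) (by simp)
    (Eventually.of_forall fun r hr =>
      hasSum_hyperKernel b ((abs_mul_one_sub_sq_le hr).trans_lt hz))
  refine Eq.trans key.tsum_eq.symm (tsum_congr fun n => ?_)
  simp only [mul_pow]
  rw [intervalIntegral.integral_const_mul, intervalIntegral.integral_const_mul,
    integral_one_sub_sq_pow, ascPochhammer_eval_two, smul_eq_mul]
  field_simp

/-- The half-plane `re z < 1` is star-shaped about `0`, so `z (1 - r²)` never leaves it, and
compactness bounds `h'` uniformly near `z₀`. Working over `ℂ` makes one differentiation under the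
integral enough for analyticity. -/
theorem differentiableOn_integral_mul_one_sub_sq {h : ℂ → ℂ}
    (hh : DifferentiableOn ℂ h {z | z.re < 1}) :
    DifferentiableOn ℂ (fun z => ∫ r in (0 : ℝ)..1, h (z * ((1 - r ^ 2 : ℝ) : ℂ)))
      {z | z.re < 1} := by
  have hU : IsOpen {z : ℂ | z.re < 1} := isOpen_lt Complex.continuous_re continuous_const
  have hmem : ∀ z : ℂ, z.re < 1 → ∀ r ∈ Set.Icc (0 : ℝ) 1,
      (z * ((1 - r ^ 2 : ℝ) : ℂ)).re < 1 := fun z hz r hr => by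
    rw [Complex.re_mul_ofReal]
    have h0 : 0 ≤ 1 - r ^ 2 := by nlinarith [hr.1, hr.2]
    have h1 : 1 - r ^ 2 ≤ 1 := by nlinarith
    rcases le_total z.re 0 with h | h
    · nlinarith
    · nlinarith
  have hd : ContinuousOn (deriv h) {z | z.re < 1} := (hh.deriv hU).continuousOn
  intro z₀ hz₀
  obtain ⟨ε, hε, hball⟩ := Metric.nhds_basis_closedBall.mem_iff.1 (hU.mem_nhds hz₀)
  have hK : IsCompact ((fun p : ℂ × ℝ => p.1 * ((1 - p.2 ^ 2 : ℝ) : ℂ)) ''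
      (Metric.closedBall z₀ ε ×ˢ Set.Icc (0 : ℝ) 1)) :=
    ((isCompact_closedBall z₀ ε).prod isCompact_Icc).image (by fun_prop)
  obtain ⟨M, hM⟩ := hK.exists_bound_of_continuousOn (hd.mono (by
    rintro _ ⟨p, hp, rfl⟩
    exact hmem _ (hball hp.1) _ hp.2))
  have hcont : ∀ z : ℂ, z.re < 1 →
      ContinuousOn (fun r : ℝ => h (z * ((1 - r ^ 2 : ℝ) : ℂ))) (Set.uIcc 0 1) := fun z hz =>
    hh.continuousOn.comp (Continuous.continuousOn (by fun_prop))
      fun r hr => hmem z hz r (by rwa [Set.uIcc_of_le zero_le_one] at hr)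
  have hm : ∀ {r : ℝ}, r ∈ Set.uIoc (0 : ℝ) 1 → r ∈ Set.Icc (0 : ℝ) 1 := fun hr => by
    rw [Set.uIoc_of_le zero_le_one] at hr
    exact ⟨hr.1.le, hr.2⟩
  refine (intervalIntegral.hasDerivAt_integral_of_dominated_loc_of_deriv_le (μ := volume)
    (F := fun (z : ℂ) (r : ℝ) => h (z * ((1 - r ^ 2 : ℝ) : ℂ)))
    (F' := fun z r => deriv h (z * ((1 - r ^ 2 : ℝ) : ℂ)) * ((1 - r ^ 2 : ℝ) : ℂ))
    (bound := fun _ => M) (Metric.closedBall_mem_nhds z₀ hε) ?_ ?_ ?_ ?_ ?_ ?_).2.differentiableAt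
      |>.differentiableWithinAt
  · filter_upwards [hU.mem_nhds hz₀] with z hz
    exact ((hcont z hz).mono Set.uIoc_subset_uIcc).aestronglyMeasurable measurableSet_uIoc
  · exact (hcont z₀ hz₀).intervalIntegrable
  · refine ContinuousOn.aestronglyMeasurable (ContinuousOn.mul ?_ (by fun_prop)) measurableSet_uIoc
    exact hd.comp (Continuous.continuousOn (by fun_prop)) fun r hr => hmem z₀ hz₀ r (hm hr)
  · refine Eventually.of_forall fun r hr z hz => ?_
    rw [norm_mul, Complex.norm_real, Real.norm_eq_abs]
    have h1 := hM _ ⟨(z, r), ⟨hz, hm hr⟩, rfl⟩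
    have h2 : |1 - r ^ 2| ≤ 1 := by
      rw [abs_le]; constructor <;> nlinarith [(hm hr).1, (hm hr).2]
    exact (mul_le_mul h1 h2 (abs_nonneg _) ((norm_nonneg _).trans h1)).trans_eq (mul_one M)
  · simp
  · refine Eventually.of_forall fun r hr z hz => ?_
    have h1 : HasDerivAt h (deriv h (z * ((1 - r ^ 2 : ℝ) : ℂ))) (z * ((1 - r ^ 2 : ℝ) : ℂ)) :=
      (hh.differentiableAt (hU.mem_nhds (hmem z (hball hz) r (hm hr)))).hasDerivAt
    simpa using! h1.comp z ((hasDerivAt_id z).mul_const ((1 - r ^ 2 : ℝ) : ℂ))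

theorem analyticOnNhd_hyperIntegral (b : ℝ) : AnalyticOnNhd ℝ (hyperIntegral b) (Set.Iio 1) := by
  set h : ℂ → ℂ := fun y => b * (1 - y) ^ (-(b + 1) : ℂ) - (b - 1) * (1 - y) ^ (-b : ℂ) with hdef
  have hU : IsOpen {z : ℂ | z.re < 1} := isOpen_lt Complex.continuous_re continuous_const
  have hh : DifferentiableOn ℂ h {z | z.re < 1} := by
    have hs : ∀ z ∈ {z : ℂ | z.re < 1}, 1 - z ∈ Complex.slitPlane := fun z hz =>
      Or.inl (by simpa using hz)
    have hd : DifferentiableOn ℂ (fun z : ℂ => 1 - z) {z | z.re < 1} := by fun_prop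
    exact ((hd.cpow_const hs).const_mul _).sub ((hd.cpow_const hs).const_mul _)
  have han := (differentiableOn_integral_mul_one_sub_sq hh).analyticOnNhd hU
  intro x hx
  have h1 : AnalyticAt ℝ (fun x : ℝ => (∫ r in (0 : ℝ)..1, h ((x : ℂ) * ((1 - r ^ 2 : ℝ) : ℂ))).re) x :=
    (Complex.reCLM.analyticAt _).comp
      (((han (x : ℂ) (by simpa using hx)).restrictScalars (𝕜 := ℝ)).comp
        (Complex.ofRealCLM.analyticAt x))
  refine h1.congr ?_
  filter_upwards [isOpen_Iio.mem_nhds hx] with z hz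
  have h2 : ∫ r in (0 : ℝ)..1, h ((z : ℂ) * ((1 - r ^ 2 : ℝ) : ℂ)) = (hyperIntegral b z : ℂ) := by
    rw [hyperIntegral, ← intervalIntegral.integral_ofReal]
    refine intervalIntegral.integral_congr fun r hr => ?_
    rw [Set.uIcc_of_le zero_le_one] at hr
    have h0 : 0 ≤ 1 - z * (1 - r ^ 2) := by
      have h0 : 0 ≤ 1 - r ^ 2 := by nlinarith [hr.1, hr.2]
      have : z < 1 := hz
      nlinarith
    simp only [hdef, hyperKernel]
    push_cast [Complex.ofReal_cpow h0]
    rfl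
  rw [h2, Complex.ofReal_re]

theorem isHypergeometricContinuation_hyperIntegral (b : ℝ) :
    IsHypergeometricContinuation 2 b (3 / 2) (hyperIntegral b) :=
  ⟨analyticOnNhd_hyperIntegral b, fun _ hz =>
    hyperIntegral_eq_ordinaryHypergeometric (abs_lt.2 hz)⟩

theorem hypergeometric_eq_hyperIntegral (b : ℝ) {z : ℝ} (hz : z < 1) :
    hypergeometric 2 b (3 / 2) z = hyperIntegral b z := by
  have h : ∃ F : ℝ → ℝ, IsHypergeometricContinuation 2 b (3 / 2) F :=
    ⟨_, isHypergeometricContinuation_hyperIntegral b⟩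
  rw [hypergeometric, dif_pos h]
  -- The chosen continuation is only known through its defining property; uniqueness identifies it
  -- with the integral.
  exact h.choose_spec.eqOn (isHypergeometricContinuation_hyperIntegral b) hz

/-! ### Decay of the hypergeometric function at `-∞`. -/

/-- The integral `∫₀¹ s (1 + X s)⁻ᵇ dr` with `s = 1 - r²`. -/
noncomputable def decayIntegral (b X : ℝ) : ℝ :=
  ∫ r in (0 : ℝ)..1, (1 - r ^ 2) * (1 + X * (1 - r ^ 2)) ^ (-b)

theorem one_sub_sq_nonneg {r : ℝ} (hr : r ∈ Set.Icc (0 : ℝ) 1) : 0 ≤ 1 - r ^ 2 := by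
  nlinarith [hr.1, hr.2]

theorem one_sub_sq_le_one (r : ℝ) : 1 - r ^ 2 ≤ 1 := by nlinarith

theorem one_le_one_add_mul_one_sub_sq {X r : ℝ} (hX : 0 ≤ X) (hr : r ∈ Set.Icc (0 : ℝ) 1) :
    1 ≤ 1 + X * (1 - r ^ 2) := by
  nlinarith [mul_nonneg hX (one_sub_sq_nonneg hr)]

theorem continuousOn_one_add_mul_rpow {X : ℝ} (hX : 0 ≤ X) (c : ℝ) :
    ContinuousOn (fun r : ℝ => (1 + X * (1 - r ^ 2)) ^ c) (Set.uIcc 0 1) := by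
  rw [Set.uIcc_of_le zero_le_one]
  exact ContinuousOn.rpow_const (Continuous.continuousOn (by fun_prop)) fun r hr =>
    Or.inl (by linarith [one_le_one_add_mul_one_sub_sq hX hr])

theorem intervalIntegrable_decay {X : ℝ} (hX : 0 ≤ X) (c : ℝ) :
    IntervalIntegrable (fun r : ℝ => (1 - r ^ 2) * (1 + X * (1 - r ^ 2)) ^ c) volume 0 1 :=
  (ContinuousOn.mul (by fun_prop) (continuousOn_one_add_mul_rpow hX c)).intervalIntegrable

theorem hyperKernel_neg (b X s : ℝ) : hyperKernel b (-X * s) =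
    b * (1 + X * s) ^ (-(b + 1)) - (b - 1) * (1 + X * s) ^ (-b) := by
  rw [hyperKernel, show 1 - -X * s = 1 + X * s by ring]

theorem continuousOn_hyperKernel {X : ℝ} (hX : 0 ≤ X) (b : ℝ) :
    ContinuousOn (fun r : ℝ => hyperKernel b (-X * (1 - r ^ 2))) (Set.uIcc 0 1) := by
  simp only [hyperKernel_neg]
  exact ((continuousOn_one_add_mul_rpow hX _).const_mul _).sub
    ((continuousOn_one_add_mul_rpow hX _).const_mul _)

/-- The derivative of `r s (1 + X s)^(-b)`, with `s = 1 - r²`, is the decaying integrand minus twice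
`r²` times the kernel, and the boundary terms vanish. -/
theorem integral_sq_mul_hyperKernel {X : ℝ} (hX : 0 ≤ X) (b : ℝ) :
    ∫ r in (0 : ℝ)..1, r ^ 2 * hyperKernel b (-X * (1 - r ^ 2)) = 1 / 2 * decayIntegral b X := by
  have hi : IntervalIntegrable (fun r : ℝ => r ^ 2 * hyperKernel b (-X * (1 - r ^ 2))) volume 0 1 :=
    (ContinuousOn.mul (by fun_prop) (continuousOn_hyperKernel hX b)).intervalIntegrable
  have h := intervalIntegral.integral_eq_sub_of_hasDerivAt (a := (0 : ℝ)) (b := 1)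
    (f := fun r : ℝ => r * ((1 - r ^ 2) * (1 + X * (1 - r ^ 2)) ^ (-b)))
    (f' := fun r => (1 - r ^ 2) * (1 + X * (1 - r ^ 2)) ^ (-b)
      - 2 * (r ^ 2 * hyperKernel b (-X * (1 - r ^ 2)))) (fun r hr => by
    rw [Set.uIcc_of_le zero_le_one] at hr
    have hp : 0 < 1 + X * (1 - r ^ 2) := by linarith [one_le_one_add_mul_one_sub_sq hX hr]
    have h1 : HasDerivAt (fun r : ℝ => 1 - r ^ 2) (-(2 * r)) r := by
      simpa using ((hasDerivAt_id r).pow 2).const_sub 1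
    have h2 : HasDerivAt (fun r : ℝ => 1 + X * (1 - r ^ 2)) (X * -(2 * r)) r :=
      (h1.const_mul X).const_add 1
    convert! (hasDerivAt_id r).mul (h1.mul (h2.rpow_const (p := -b) (Or.inl hp.ne'))) using 1
    have e : (1 + X * (1 - r ^ 2)) ^ (-b) =
        (1 + X * (1 - r ^ 2)) * (1 + X * (1 - r ^ 2)) ^ (-(b + 1)) := by
      have := Real.rpow_add hp 1 (-(b + 1))
      rw [Real.rpow_one] at this
      rw [← this]
      congr 1
      ring
    rw [hyperKernel_neg, show -b - 1 = -(b + 1) by ring, e]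
    simp only [id_eq, Pi.mul_apply, e]
    ring) ((intervalIntegrable_decay hX _).sub (hi.const_mul 2))
  rw [intervalIntegral.integral_sub (intervalIntegrable_decay hX _) (hi.const_mul 2),
    intervalIntegral.integral_const_mul] at h
  rw [decayIntegral]
  simp only [one_pow, sub_self, zero_mul, mul_zero] at h
  linarith

/-- A direct bound on the kernel loses the decay: the endpoint `r = 1` alone contributes order `1/X`
when `b > 1`. Splitting `1 = r² + (1 - r²)` and integrating the first part exactly puts a factor `1
- r²`, which vanishes at that endpoint, in front of everything. -/
theorem abs_hyperIntegral_le {b X : ℝ} (hb : 0 < b) (hX : 0 ≤ X) :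
    |hyperIntegral b (-X)| ≤ (1 / 2 + b + |b - 1|) * decayIntegral b X := by
  have hc := continuousOn_hyperKernel hX b
  have h0 : hyperIntegral b (-X) = 1 / 2 * decayIntegral b X +
      ∫ r in (0 : ℝ)..1, (1 - r ^ 2) * hyperKernel b (-X * (1 - r ^ 2)) := by
    have h1 : IntervalIntegrable (fun r : ℝ => r ^ 2 * hyperKernel b (-X * (1 - r ^ 2)))
        volume 0 1 := (ContinuousOn.mul (by fun_prop) hc).intervalIntegrable
    have h2 : IntervalIntegrable (fun r : ℝ => (1 - r ^ 2) * hyperKernel b (-X * (1 - r ^ 2)))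
        volume 0 1 := (ContinuousOn.mul (by fun_prop) hc).intervalIntegrable
    rw [← integral_sq_mul_hyperKernel hX, hyperIntegral, ← intervalIntegral.integral_add h1 h2]
    exact intervalIntegral.integral_congr fun r _ => by ring
  have h1 : |∫ r in (0 : ℝ)..1, (1 - r ^ 2) * hyperKernel b (-X * (1 - r ^ 2))| ≤
      (b + |b - 1|) * decayIntegral b X := by
    rw [decayIntegral, ← intervalIntegral.integral_const_mul, ← Real.norm_eq_abs]
    refine intervalIntegral.norm_integral_le_of_norm_le zero_le_one
      (Eventually.of_forall fun r hr => ?_) ((intervalIntegrable_decay hX _).const_mul _)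
    have hr' : r ∈ Set.Icc (0 : ℝ) 1 := ⟨hr.1.le, hr.2⟩
    have hp := one_le_one_add_mul_one_sub_sq hX hr'
    have hle : (1 + X * (1 - r ^ 2)) ^ (-(b + 1)) ≤ (1 + X * (1 - r ^ 2)) ^ (-b) :=
      Real.rpow_le_rpow_of_exponent_le hp (by linarith)
    have hq : 0 ≤ (1 + X * (1 - r ^ 2)) ^ (-(b + 1)) := by positivity
    have hq' : 0 ≤ (1 + X * (1 - r ^ 2)) ^ (-b) := by positivity
    rw [Real.norm_eq_abs, abs_mul, abs_of_nonneg (one_sub_sq_nonneg hr'), mul_left_comm]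
    refine mul_le_mul_of_nonneg_left ?_ (one_sub_sq_nonneg hr')
    rw [hyperKernel_neg, add_mul]
    refine (abs_sub _ _).trans (add_le_add ?_ ?_)
    · rw [abs_mul, abs_of_pos hb, abs_of_nonneg hq]
      exact mul_le_mul_of_nonneg_left hle hb.le
    · rw [abs_mul, abs_of_nonneg hq']
  have h2 : 0 ≤ decayIntegral b X := by
    refine intervalIntegral.integral_nonneg zero_le_one fun r hr => ?_
    have := one_le_one_add_mul_one_sub_sq hX hr
    exact mul_nonneg (one_sub_sq_nonneg hr) (by positivity)
  rw [h0]
  refine (abs_add_le _ _).trans ?_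
  rw [abs_of_nonneg (by positivity)]
  linarith

theorem decayIntegral_le_one {b X : ℝ} (hb : 0 ≤ b) (hX : 0 ≤ X) : decayIntegral b X ≤ 1 := by
  have h := intervalIntegral.integral_mono_on zero_le_one (intervalIntegrable_decay hX (-b))
    (intervalIntegrable_const (c := (1 : ℝ))) fun r hr => ?_
  · simpa [decayIntegral] using h
  · have := one_le_one_add_mul_one_sub_sq hX hr
    exact mul_le_one₀ (one_sub_sq_le_one r) (by positivity)
      (Real.rpow_le_one_of_one_le_of_nonpos this (by linarith))

theorem decayIntegral_le_inv {b X : ℝ} (hb : 1 ≤ b) (hX : 0 ≤ X) :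
    decayIntegral b X ≤ (1 + X)⁻¹ := by
  have h := intervalIntegral.integral_mono_on zero_le_one (intervalIntegrable_decay hX (-b))
    (intervalIntegrable_const (c := (1 + X)⁻¹)) fun r hr => ?_
  · simpa [decayIntegral] using h
  · have h1 := one_le_one_add_mul_one_sub_sq hX hr
    have h2 : (1 + X * (1 - r ^ 2)) ^ (-b) ≤ (1 + X * (1 - r ^ 2))⁻¹ := by
      rw [← Real.rpow_neg_one]
      exact Real.rpow_le_rpow_of_exponent_le h1 (by linarith)
    refine (mul_le_mul_of_nonneg_left h2 (one_sub_sq_nonneg hr)).trans ?_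
    rw [← div_eq_mul_inv, div_le_iff₀ (by linarith), inv_mul_eq_div, le_div_iff₀ (by linarith)]
    nlinarith [one_sub_sq_le_one r]

theorem intervalIntegrable_one_add_mul_rpow {X : ℝ} (hX : 0 ≤ X) (c : ℝ) :
    IntervalIntegrable (fun u : ℝ => (1 + X * u) ^ c) volume 0 1 := by
  refine ContinuousOn.intervalIntegrable (ContinuousOn.rpow_const (by fun_prop) fun u hu => Or.inl ?_)
  rw [Set.uIcc_of_le zero_le_one] at hu
  nlinarith [mul_nonneg hX hu.1]

/-- With `u = 1 - r` one has `u ≤ 1 - r² ≤ 2u` and `X u ≤ 1 + X u`, so the factor `1 - r²` is traded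
for one power of `1 + X u`. The elementary integral left over produces the three regimes `b < 2`, `b
= 2`, `b > 2`. -/
theorem decayIntegral_le_integral {b X : ℝ} (hb : 0 ≤ b) (hX : 0 < X) :
    decayIntegral b X ≤ 2 / X * ∫ u in (0 : ℝ)..1, (1 + X * u) ^ (1 - b) := by
  have hi := intervalIntegrable_one_add_mul_rpow hX.le (1 - b)
  have hsub := intervalIntegral.integral_comp_sub_left (fun u : ℝ => (1 + X * u) ^ (1 - b))
    (a := 0) (b := 1) 1
  have hi' : IntervalIntegrable (fun r : ℝ => (1 + X * (1 - r)) ^ (1 - b)) volume 0 1 := by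
    simpa using! (hi.comp_sub_left 1).symm
  rw [sub_self, sub_zero] at hsub
  rw [← hsub, ← intervalIntegral.integral_const_mul]
  refine intervalIntegral.integral_mono_on zero_le_one (intervalIntegrable_decay hX.le (-b))
    (hi'.const_mul _) fun r hr => ?_
  have hu : 0 ≤ 1 - r := by linarith [hr.2]
  have hq : 0 < 1 + X * (1 - r) := by positivity
  have h1 : (1 + X * (1 - r ^ 2)) ^ (-b) ≤ (1 + X * (1 - r)) ^ (-b) :=
    Real.rpow_le_rpow_of_nonpos hq
      (by nlinarith [mul_nonneg (mul_nonneg hX.le hu) hr.1]) (by linarith)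
  have h2 : (1 + X * (1 - r)) ^ (1 - b) = (1 + X * (1 - r)) * (1 + X * (1 - r)) ^ (-b) := by
    rw [show 1 - b = 1 + -b by ring, Real.rpow_add hq, Real.rpow_one]
  have h3 : 0 ≤ (1 + X * (1 - r)) ^ (-b) := by positivity
  refine (mul_le_mul_of_nonneg_left h1 (one_sub_sq_nonneg hr)).trans ?_
  rw [h2, ← mul_assoc]
  refine mul_le_mul_of_nonneg_right ?_ h3
  rw [div_mul_eq_mul_div, le_div_iff₀ hX]
  nlinarith [mul_nonneg hX.le hu, mul_nonneg (mul_nonneg hX.le hu) hu]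

theorem integral_one_add_mul_rpow {c X : ℝ} (hX : 0 < X) (hc : c + 1 ≠ 0) :
    ∫ u in (0 : ℝ)..1, (1 + X * u) ^ c = ((1 + X) ^ (c + 1) - 1) / (X * (c + 1)) := by
  rw [intervalIntegral.integral_eq_sub_of_hasDerivAt
    (f := fun u => (1 + X * u) ^ (c + 1) / (X * (c + 1))) (fun u hu => ?_)
    (intervalIntegrable_one_add_mul_rpow hX.le c)]
  · simp [sub_div]
  · rw [Set.uIcc_of_le zero_le_one] at hu
    have hq : 0 < 1 + X * u := by nlinarith [mul_nonneg hX.le hu.1]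
    have h1 : HasDerivAt (fun u => 1 + X * u) X u := by
      simpa using ((hasDerivAt_id u).const_mul X).const_add 1
    convert! (h1.rpow_const (p := c + 1) (Or.inl hq.ne')).div_const (X * (c + 1)) using 1
    rw [add_sub_cancel_right]
    field_simp

theorem decayIntegral_le_of_lt_two {b X : ℝ} (hb : 0 ≤ b) (hb2 : b < 2) (hX : 0 < X) :
    decayIntegral b X ≤ 2 / (2 - b) * ((1 + X) ^ (2 - b) / X ^ 2) := by
  refine (decayIntegral_le_integral hb hX).trans ?_
  rw [integral_one_add_mul_rpow hX (by linarith), show 1 - b + 1 = 2 - b by ring]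
  have : 0 < 2 - b := by linarith
  field_simp
  linarith

theorem decayIntegral_le_of_two_lt {b X : ℝ} (hb2 : 2 < b) (hX : 0 < X) :
    decayIntegral b X ≤ 2 / (b - 2) * (1 / X ^ 2) := by
  refine (decayIntegral_le_integral (by linarith) hX).trans ?_
  rw [integral_one_add_mul_rpow hX (by linarith), show 1 - b + 1 = -(b - 2) by ring]
  have : 0 < b - 2 := by linarith
  have : 0 ≤ (1 + X) ^ (-(b - 2)) := by positivity
  rw [show 2 / X * (((1 + X) ^ (-(b - 2)) - 1) / (X * -(b - 2))) =
    2 / (b - 2) * ((1 - (1 + X) ^ (-(b - 2))) / X ^ 2) by field_simp; ring]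
  gcongr
  linarith

theorem decayIntegral_two_le {X : ℝ} (hX : 0 < X) :
    decayIntegral 2 X ≤ 2 * (Real.log (1 + X) / X ^ 2) := by
  refine (decayIntegral_le_integral (by norm_num) hX).trans_eq ?_
  rw [intervalIntegral.integral_eq_sub_of_hasDerivAt
    (f := fun u => Real.log (1 + X * u) / X) (fun u hu => ?_)
    (intervalIntegrable_one_add_mul_rpow hX.le _)]
  · simp
    field_simp
  · rw [Set.uIcc_of_le zero_le_one] at hu
    have hq : 0 < 1 + X * u := by nlinarith [mul_nonneg hX.le hu.1]
    have h1 : HasDerivAt (fun u => 1 + X * u) X u := by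
      simpa using ((hasDerivAt_id u).const_mul X).const_add 1
    convert! (h1.log hq.ne').div_const X using 1
    rw [show (1 : ℝ) - 2 = -1 by norm_num, Real.rpow_neg_one]
    field_simp

/-! ### Closed form and decay of the potential. -/

/-- Here an upper and the lower parameter cancel and the series is that of `(1 - z)^(-2)`. This is
what the separate case `ν = 1` of the potential needs. -/
theorem hyperIntegral_three_halves {z : ℝ} (hz : z < 1) :
    hyperIntegral (3 / 2) z = ((1 - z) ^ 2)⁻¹ := by
  have h : IsHypergeometricContinuation 2 (3 / 2) (3 / 2) fun z => ((1 - z) ^ 2)⁻¹ := by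
    refine ⟨fun x hx => ?_, fun z hz => ?_⟩
    · have h1 : AnalyticAt ℝ (fun z : ℝ => (1 - z) ^ 2) x := by fun_prop
      exact h1.inv (pow_pos (sub_pos.2 hx) 2).ne'
    · have h1 := (hasSum_one_sub_rpow_neg 2 (abs_lt.2 hz)).tsum_eq
      rw [Real.rpow_neg (by linarith [hz.2]), Real.rpow_two] at h1
      dsimp only
      rw [← h1, ordinaryHypergeometric_eq_tsum]
      refine tsum_congr fun n => ?_
      have : 0 < (ascPochhammer ℝ n).eval (3 / 2) := ascPochhammer_pos n _ (by norm_num)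
      rw [smul_eq_mul]
      field_simp
  exact (isHypergeometricContinuation_hyperIntegral _).eqOn h hz

/-- The constant `4 Γ(ν + 1/2) / (√π Γ(ν))`. -/
noncomputable def potentialConst (ν : ℝ) : ℝ :=
  4 * Real.Gamma (ν + 1 / 2) / (Real.sqrt Real.pi * Real.Gamma ν)

theorem one_add_sq_pos (x : ℝ) : 0 < 1 + x ^ 2 := by positivity

/-- Written with `Γ(ν + 1/2)` and `Γ(ν)`, the constant has no singularity at `ν = 1`, and both cases
of the definition become one formula. -/
theorem potential_eq {ν : ℝ} (hν : 0 < ν) (hν' : ν ≠ 1 / 2) (x : ℝ) :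
    potential ν x =
      -(potentialConst ν * (1 + x ^ 2) ^ ν * hyperIntegral (ν + 1 / 2) (-x ^ 2)) := by
  have hz : -x ^ 2 < 1 := by nlinarith [sq_nonneg x]
  have hpi : 0 < Real.sqrt Real.pi := Real.sqrt_pos.2 Real.pi_pos
  by_cases h1 : ν = 1
  · subst h1
    have hG : Real.Gamma (1 + 1 / 2) = 1 / 2 * Real.sqrt Real.pi := by
      rw [add_comm, Real.Gamma_add_one (by norm_num), Real.Gamma_one_half_eq]
    have hpos := one_add_sq_pos x
    rw [potential, if_pos rfl, potentialConst, hG, Real.Gamma_one,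
      show (1 : ℝ) + 1 / 2 = 3 / 2 by norm_num, hyperIntegral_three_halves hz, Real.rpow_one,
      sub_neg_eq_add]
    field_simp
    norm_num
  · rw [potential, if_neg h1, add_comm (1 / 2) ν, hypergeometric_eq_hyperIntegral _ hz,
      potentialConst]
    have hG1 : Real.Gamma (ν + 1 / 2) = (ν - 1 / 2) * Real.Gamma (ν - 1 / 2) := by
      rw [← Real.Gamma_add_one (sub_ne_zero.2 hν')]; ring_nf
    have hG2 : Real.Gamma ν = (ν - 1) * Real.Gamma (ν - 1) := by
      rw [← Real.Gamma_add_one (sub_ne_zero.2 h1)]; ring_nf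
    have hpos : Real.Gamma ν ≠ 0 := (Real.Gamma_pos_of_pos hν).ne'
    -- Nonvanishing of `Γ(ν) = (ν - 1) Γ(ν - 1)` also supplies `Γ(ν - 1) ≠ 0`, although `ν - 1` may
    -- be negative.
    rw [hG2] at hpos ⊢
    rw [hG1]
    have hne : ν - 1 ≠ 0 := left_ne_zero_of_mul hpos
    have hne' : 1 - ν ≠ 0 := fun h => hne (by linarith)
    have hG0 : Real.Gamma (ν - 1) ≠ 0 := right_ne_zero_of_mul hpos
    field_simp
    ring

theorem potential_mul_zeroMode {ν : ℝ} (hν : 0 < ν) (hν' : ν ≠ 1 / 2) (x : ℝ) :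
    potential ν x * zeroMode ν x =
      -(potentialConst ν * x * hyperIntegral (ν + 1 / 2) (-x ^ 2)) := by
  have : (1 + x ^ 2) ^ ν ≠ 0 := (Real.rpow_pos_of_pos (one_add_sq_pos x) ν).ne'
  rw [potential_eq hν hν', zeroMode]
  field_simp

theorem potentialConst_pos {ν : ℝ} (hν : 0 < ν) : 0 < potentialConst ν := by
  have := Real.Gamma_pos_of_pos hν
  have := Real.Gamma_pos_of_pos (show 0 < ν + 1 / 2 by linarith)
  have := Real.pi_pos
  unfold potentialConst
  positivity

theorem exists_abs_potential_le {ν : ℝ} (hν : 0 < ν) (hν' : ν ≠ 1 / 2) :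
    ∃ K, 0 ≤ K ∧ ∀ x, |potential ν x| ≤ K * ((1 + x ^ 2) ^ ν * decayIntegral (ν + 1 / 2) (x ^ 2)) := by
  have hC := potentialConst_pos hν
  refine ⟨potentialConst ν * (1 / 2 + (ν + 1 / 2) + |ν + 1 / 2 - 1|), by positivity, fun x => ?_⟩
  have hp : 0 < (1 + x ^ 2) ^ ν := Real.rpow_pos_of_pos (one_add_sq_pos x) ν
  have h := abs_hyperIntegral_le (b := ν + 1 / 2) (by linarith) (sq_nonneg x)
  rw [potential_eq hν hν', abs_neg, abs_mul, abs_of_pos (mul_pos hC hp)]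
  calc _ ≤ potentialConst ν * (1 + x ^ 2) ^ ν * _ := mul_le_mul_of_nonneg_left h (by positivity)
    _ = _ := by ring

theorem exists_abs_potential_mul_zeroMode_le {ν : ℝ} (hν : 0 < ν) (hν' : ν ≠ 1 / 2) :
    ∃ K, 0 ≤ K ∧ ∀ x, |potential ν x * zeroMode ν x| ≤
      K * (|x| * decayIntegral (ν + 1 / 2) (x ^ 2)) := by
  have hC := potentialConst_pos hν
  refine ⟨potentialConst ν * (1 / 2 + (ν + 1 / 2) + |ν + 1 / 2 - 1|), by positivity, fun x => ?_⟩
  have h := abs_hyperIntegral_le (b := ν + 1 / 2) (by linarith) (sq_nonneg x)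
  rw [potential_mul_zeroMode hν hν', abs_neg, abs_mul, abs_mul, abs_of_pos hC]
  calc _ ≤ potentialConst ν * |x| * _ := mul_le_mul_of_nonneg_left h (by positivity)
    _ = _ := by ring

theorem continuous_potential_mul_zeroMode {ν : ℝ} (hν : 0 < ν) (hν' : ν ≠ 1 / 2) :
    Continuous fun x => potential ν x * zeroMode ν x := by
  simp only [potential_mul_zeroMode hν hν']
  refine Continuous.neg (Continuous.mul (by fun_prop) ?_)
  exact (analyticOnNhd_hyperIntegral _).continuousOn.comp_continuous (by fun_prop) fun x => by
    show -x ^ 2 < 1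
    nlinarith [sq_nonneg x]

theorem continuous_zeroMode (ν : ℝ) : Continuous (zeroMode ν) := by
  unfold zeroMode
  refine continuous_id.div (Continuous.rpow_const (by fun_prop) fun x =>
    Or.inl (one_add_sq_pos x).ne') fun x => (Real.rpow_pos_of_pos (one_add_sq_pos x) ν).ne'

theorem odd_zeroMode (ν : ℝ) : Function.Odd (zeroMode ν) := fun x => by
  simp [zeroMode, neg_div]

theorem eventually_cocompact_le_abs (R : ℝ) : ∀ᶠ x in cocompact ℝ, R ≤ |x| :=
  (tendsto_norm_cocompact_atTop (E := ℝ)).eventually_ge_atTop R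

theorem one_add_sq_rpow_le {x c : ℝ} (hc : 0 ≤ c) (hx : 1 ≤ |x|) :
    (1 + x ^ 2) ^ c ≤ 2 ^ c * |x| ^ (2 * c) := by
  have h0 : 0 ≤ |x| := abs_nonneg x
  rw [Real.rpow_mul h0, ← Real.mul_rpow (by norm_num) (by positivity), Real.rpow_two, sq_abs]
  refine Real.rpow_le_rpow (one_add_sq_pos x).le ?_ hc
  nlinarith [sq_abs x]

theorem potential_isBigO_of_lt {ν : ℝ} (hν : 1 / 2 < ν) (hν' : ν < 3 / 2) :
    potential ν =O[cocompact ℝ] fun x : ℝ => 1 / |x| := by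
  obtain ⟨K, hK, h⟩ := exists_abs_potential_le (by linarith) hν.ne'
  refine IsBigO.of_bound (K * (2 / (3 / 2 - ν) * 2 ^ (3 / 2 : ℝ))) ?_
  filter_upwards [eventually_cocompact_le_abs 1] with x hx
  have hx0 : 0 < |x| := by linarith
  have hx2 : 0 < x ^ 2 := by rw [← sq_abs]; positivity
  rw [Real.norm_eq_abs, Real.norm_eq_abs, abs_of_pos (show 0 < 1 / |x| by positivity), mul_assoc]
  refine (h x).trans (mul_le_mul_of_nonneg_left ?_ hK)
  have h1 := decayIntegral_le_of_lt_two (b := ν + 1 / 2) (by linarith) (by linarith) hx2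
  refine (mul_le_mul_of_nonneg_left h1 (by positivity)).trans ?_
  have h2 := one_add_sq_rpow_le (x := x) (c := 3 / 2) (by norm_num) hx
  -- The growth `(1 + x²)^ν` and the power from the decay bound at `b = ν + 1/2` always combine to
  -- exponent `3/2`; divided by `x⁴` this is of order `1/|x|` for every `ν` in the range.
  have h3 : (1 + x ^ 2) ^ ν * (1 + x ^ 2) ^ (2 - (ν + 1 / 2)) = (1 + x ^ 2) ^ (3 / 2 : ℝ) := by
    rw [← Real.rpow_add (one_add_sq_pos x)]; ring_nf
  have h4 : |x| ^ (2 * (3 / 2) : ℝ) = |x| ^ 3 := by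
    rw [show (2 * (3 / 2) : ℝ) = (3 : ℕ) by norm_num, Real.rpow_natCast]
  have h5 : 0 < 3 / 2 - ν := by linarith
  rw [h4] at h2
  rw [show 2 - (ν + 1 / 2) = 3 / 2 - ν by ring] at h3 ⊢
  calc _ = 2 / (3 / 2 - ν) * (((1 + x ^ 2) ^ ν * (1 + x ^ 2) ^ (3 / 2 - ν)) / (x ^ 2) ^ 2) := by ring
    _ ≤ 2 / (3 / 2 - ν) * ((2 ^ (3 / 2 : ℝ) * |x| ^ 3) / (x ^ 2) ^ 2) := by rw [h3]; gcongr
    _ = _ := by rw [← sq_abs x]; field_simp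

theorem potential_one_isBigO : potential 1 =O[cocompact ℝ] fun x : ℝ => 1 / |x| ^ 2 := by
  refine IsBigO.of_bound 2 ?_
  filter_upwards [eventually_cocompact_le_abs 1] with x hx
  have hx2 : 0 < x ^ 2 := by rw [← sq_abs]; positivity
  rw [potential, if_pos rfl, sq_abs, Real.norm_eq_abs, Real.norm_eq_abs, abs_div, abs_neg,
    abs_of_pos (one_add_sq_pos x), abs_of_pos (by positivity : 0 < 1 / x ^ 2), abs_two,
    mul_one_div]
  gcongr
  linarith

theorem potential_three_halves_isBigO :
    potential (3 / 2) =O[cocompact ℝ] fun x : ℝ => Real.log |x| / |x| := by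
  obtain ⟨K, hK, h⟩ := exists_abs_potential_le (ν := 3 / 2) (by norm_num) (by norm_num)
  refine IsBigO.of_bound (K * (6 * 2 ^ (3 / 2 : ℝ))) ?_
  filter_upwards [eventually_cocompact_le_abs 2] with x hx
  have hx0 : 0 < |x| := by linarith
  have hx2 : 0 < x ^ 2 := by rw [← sq_abs]; positivity
  have hlog : 0 < Real.log |x| := Real.log_pos (by linarith)
  rw [Real.norm_eq_abs, Real.norm_eq_abs, abs_of_pos (show 0 < Real.log |x| / |x| by positivity),
    mul_assoc]
  refine (h x).trans (mul_le_mul_of_nonneg_left ?_ hK)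
  rw [show (3 / 2 + 1 / 2 : ℝ) = 2 by norm_num]
  refine (mul_le_mul_of_nonneg_left (decayIntegral_two_le hx2) (by positivity)).trans ?_
  have h2 := one_add_sq_rpow_le (x := x) (c := 3 / 2) (by norm_num) (by linarith)
  have h4 : |x| ^ (2 * (3 / 2) : ℝ) = |x| ^ 3 := by
    rw [show (2 * (3 / 2) : ℝ) = (3 : ℕ) by norm_num, Real.rpow_natCast]
  rw [h4] at h2
  -- For `|x| ≥ 2`, `1 + x² ≤ |x|³`.
  have h3 : Real.log (1 + x ^ 2) ≤ 3 * Real.log |x| := by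
    rw [← Real.log_rpow hx0]
    refine Real.log_le_log (one_add_sq_pos x) ?_
    rw [show (3 : ℝ) = (3 : ℕ) by norm_num, Real.rpow_natCast]
    nlinarith [sq_abs x, mul_le_mul_of_nonneg_right hx (sq_nonneg |x|)]
  calc _ ≤ 2 ^ (3 / 2 : ℝ) * |x| ^ 3 * (2 * (3 * Real.log |x| / (x ^ 2) ^ 2)) := by
        gcongr
        exact mul_nonneg (by norm_num) (div_nonneg (Real.log_nonneg (by linarith)) (by positivity))
    _ = _ := by rw [← sq_abs x]; field_simp; ring

theorem potential_isBigO_of_gt {ν : ℝ} (hν : 3 / 2 < ν) :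
    potential ν =O[cocompact ℝ] fun x : ℝ => 1 / |x| ^ (4 - 2 * ν) := by
  obtain ⟨K, hK, h⟩ := exists_abs_potential_le (ν := ν) (by linarith) (by linarith)
  refine IsBigO.of_bound (K * (2 / (ν - 3 / 2) * 2 ^ ν)) ?_
  filter_upwards [eventually_cocompact_le_abs 1] with x hx
  have hx0 : 0 < |x| := by linarith
  have hx2 : 0 < x ^ 2 := by rw [← sq_abs]; positivity
  rw [Real.norm_eq_abs, Real.norm_eq_abs,
    abs_of_pos (show 0 < 1 / |x| ^ (4 - 2 * ν) by positivity), mul_assoc]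
  refine (h x).trans (mul_le_mul_of_nonneg_left ?_ hK)
  have h1 := decayIntegral_le_of_two_lt (b := ν + 1 / 2) (by linarith) hx2
  refine (mul_le_mul_of_nonneg_left h1 (by positivity)).trans ?_
  have h2 := one_add_sq_rpow_le (x := x) (c := ν) (by linarith) hx
  have h5 : 0 < ν - 3 / 2 := by linarith
  rw [show ν + 1 / 2 - 2 = ν - 3 / 2 by ring]
  have h6 : |x| ^ (2 * ν) = |x| ^ 4 / |x| ^ (4 - 2 * ν) := by
    rw [eq_div_iff (by positivity), ← Real.rpow_add hx0, ← Real.rpow_natCast]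
    norm_num
  rw [h6] at h2
  calc _ ≤ 2 ^ ν * (|x| ^ 4 / |x| ^ (4 - 2 * ν)) * (2 / (ν - 3 / 2) * (1 / (x ^ 2) ^ 2)) := by
        gcongr
    _ = _ := by rw [← sq_abs x]; field_simp

/-! ### Integrability of `v_ν` and `Ṽ_ν v_ν`. -/

theorem zeroMode_sq (ν x : ℝ) : zeroMode ν x ^ 2 = x ^ 2 * (1 + x ^ 2) ^ (-(2 * ν)) := by
  rw [zeroMode, div_pow, ← Real.rpow_natCast ((1 + x ^ 2) ^ ν),
    ← Real.rpow_mul (one_add_sq_pos x).le, Real.rpow_neg (one_add_sq_pos x).le, div_eq_mul_inv]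
  ring_nf

theorem memLp_two_zeroMode {ν : ℝ} (hν : 3 / 4 < ν) : MemLp (zeroMode ν) 2 volume := by
  rw [memLp_two_iff_integrable_sq (continuous_zeroMode ν).aestronglyMeasurable]
  -- `v_ν² ≤ (1 + x²)^(1 - 2ν)`, that is, exponent `-r/2` with `r = 4ν - 2`; the requirement `r > 1`
  -- is `ν > 3/4`.
  have hi := integrable_rpow_neg_one_add_norm_sq (E := ℝ) (μ := volume) (r := 4 * ν - 2)
    (by simp; linarith)
  refine hi.mono' ((continuous_zeroMode ν).pow 2).aestronglyMeasurable
    (Eventually.of_forall fun x => ?_)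
  rw [Real.norm_eq_abs, abs_of_nonneg (sq_nonneg _), zeroMode_sq, Real.norm_eq_abs, sq_abs,
    show -(4 * ν - 2) / 2 = 1 + -(2 * ν) by ring, Real.rpow_add (one_add_sq_pos x), Real.rpow_one]
  have := Real.rpow_pos_of_pos (one_add_sq_pos x) (-(2 * ν))
  gcongr
  linarith

theorem not_memLp_two_zeroMode {ν : ℝ} (hν : ν ≤ 3 / 4) : ¬ MemLp (zeroMode ν) 2 volume := by
  rw [memLp_two_iff_integrable_sq (continuous_zeroMode ν).aestronglyMeasurable]
  intro h
  -- For `x > 1` and `ν ≤ 3/4`, `v_ν²` dominates a multiple of `1/x`, so divergence includes the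
  -- endpoint `ν = 3/4`.
  refine not_integrableOn_Ioi_inv (a := 1) ?_
  refine (h.integrableOn.const_mul (2 ^ (3 / 2 : ℝ))).mono'
    measurable_inv.aestronglyMeasurable ?_
  filter_upwards [ae_restrict_mem measurableSet_Ioi] with x hx
  have hx0 : 0 < x := zero_lt_one.trans hx
  have hx1 : (1 : ℝ) < x := hx
  rw [zeroMode_sq, Real.norm_eq_abs, abs_of_pos (inv_pos.2 hx0)]
  have h1 : (1 + x ^ 2) ^ (-(3 / 2) : ℝ) ≤ (1 + x ^ 2) ^ (-(2 * ν)) :=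
    Real.rpow_le_rpow_of_exponent_le (by nlinarith) (by linarith)
  have h2 := one_add_sq_rpow_le (x := x) (c := 3 / 2) (by norm_num) (by rw [abs_of_pos hx0]; linarith)
  have h4 : |x| ^ (2 * (3 / 2) : ℝ) = x ^ 3 := by
    
    rw [abs_of_pos hx0, show (2 * (3 / 2) : ℝ) = (3 : ℕ) by norm_num, Real.rpow_natCast]
  rw [h4] at h2
  rw [Real.rpow_neg (one_add_sq_pos x).le] at h1
  calc x⁻¹ = 2 ^ (3 / 2 : ℝ) * (x ^ 2 * (2 ^ (3 / 2 : ℝ) * x ^ 3)⁻¹) := by field_simp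
    _ ≤ 2 ^ (3 / 2 : ℝ) * (x ^ 2 * ((1 + x ^ 2) ^ (3 / 2 : ℝ))⁻¹) := by gcongr
    _ ≤ _ := by gcongr

theorem tendsto_zeroMode_cocompact {ν : ℝ} (hν : 1 / 2 < ν) :
    Tendsto (zeroMode ν) (cocompact ℝ) (𝓝 0) := by
  have h1 : Tendsto (fun x : ℝ => |x|) (cocompact ℝ) atTop := tendsto_norm_cocompact_atTop (E := ℝ)
  have h2 := (tendsto_rpow_neg_atTop (show 0 < 2 * ν - 1 by linarith)).comp h1
  refine squeeze_zero_norm' ?_ h2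
  filter_upwards [eventually_cocompact_le_abs 1] with x hx
  have hx0 : 0 < |x| := by linarith
  have h3 : |x| ^ (2 * ν) ≤ (1 + x ^ 2) ^ ν := by
    rw [Real.rpow_mul hx0.le, Real.rpow_two, sq_abs]
    exact Real.rpow_le_rpow (sq_nonneg x) (by linarith) (by linarith)
  rw [zeroMode, Real.norm_eq_abs, abs_div,
    abs_of_pos (Real.rpow_pos_of_pos (one_add_sq_pos x) ν), Function.comp_apply,
    div_le_iff₀ (Real.rpow_pos_of_pos (one_add_sq_pos x) ν)]
  calc |x| = |x| ^ (-(2 * ν - 1)) * |x| ^ (2 * ν) := by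
        rw [← Real.rpow_add hx0]; ring_nf; simp
    _ ≤ _ := by gcongr

theorem memLp_two_potential_mul_zeroMode {ν : ℝ} (hν : 1 / 2 < ν) :
    MemLp (fun x => potential ν x * zeroMode ν x) 2 volume := by
  have hc := continuous_potential_mul_zeroMode (by linarith) hν.ne'
  rw [memLp_two_iff_integrable_sq hc.aestronglyMeasurable]
  obtain ⟨K, hK, h⟩ := exists_abs_potential_mul_zeroMode_le (by linarith) hν.ne'
  refine (integrable_inv_one_add_sq.const_mul (K ^ 2)).mono' (hc.pow 2).aestronglyMeasurable
    (Eventually.of_forall fun x => ?_)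
  have h1 := decayIntegral_le_inv (b := ν + 1 / 2) (by linarith) (sq_nonneg x)
  have h2 : |potential ν x * zeroMode ν x| ≤ K * (|x| * (1 + x ^ 2)⁻¹) :=
    (h x).trans (by gcongr)
  rw [Real.norm_eq_abs, abs_of_nonneg (sq_nonneg _), ← sq_abs]
  refine (pow_le_pow_left₀ (abs_nonneg _) h2 2).trans ?_
  rw [mul_pow, mul_pow, sq_abs]
  have := one_add_sq_pos x
  gcongr
  rw [inv_pow, ← div_eq_mul_inv, div_le_iff₀ (by positivity)]
  field_simp
  linarith

theorem integrable_potential_mul_zeroMode_mul {ν : ℝ} (hν : 0 < ν) (hν' : ν ≠ 1 / 2)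
    (φ : 𝓢(ℝ, ℂ)) : Integrable fun x : ℝ => ((potential ν x * zeroMode ν x : ℝ) : ℂ) * φ x := by
  obtain ⟨K, hK, h⟩ := exists_abs_potential_mul_zeroMode_le hν hν'
  have hi : Integrable fun x : ℝ => K * (‖x‖ ^ 1 * ‖φ x‖) := (φ.integrable_pow_mul volume 1).const_mul K
  refine hi.mono' (Continuous.aestronglyMeasurable (Continuous.mul
    (Complex.continuous_ofReal.comp (continuous_potential_mul_zeroMode hν hν')) φ.continuous))
    (Eventually.of_forall fun x => ?_)
  have h1 := decayIntegral_le_one (b := ν + 1 / 2) (by linarith) (sq_nonneg x)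
  rw [norm_mul, Complex.norm_real, Real.norm_eq_abs, Real.norm_eq_abs, pow_one, ← mul_assoc]
  refine mul_le_mul_of_nonneg_right ((h x).trans ?_) (norm_nonneg _)
  exact mul_le_mul_of_nonneg_left (mul_le_of_le_one_right (abs_nonneg x) h1) hK

/-! ### Half-line trigonometric moments of a Gaussian. -/

theorem integrable_pow_mul_exp_neg_mul_sq {a : ℝ} (ha : 0 < a) (n : ℕ) :
    Integrable fun k : ℝ => k ^ n * Real.exp (-a * k ^ 2) := by
  have h := integrable_rpow_mul_exp_neg_mul_sq ha (s := n) (by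
    have : (0 : ℝ) ≤ n := Nat.cast_nonneg n
    linarith)
  simpa only [Real.rpow_natCast] using h

theorem integrable_pow_mul_exp_mul_of_abs_le_one {a : ℝ} (ha : 0 < a) (n : ℕ) {f : ℝ → ℝ}
    (hf : Continuous f) (hf' : ∀ k, |f k| ≤ 1) :
    Integrable fun k : ℝ => k ^ n * Real.exp (-a * k ^ 2) * f k := by
  refine (integrable_pow_mul_exp_neg_mul_sq ha n).norm.mono'
    (Continuous.aestronglyMeasurable (by fun_prop)) (Eventually.of_forall fun k => ?_)
  rw [norm_mul]
  exact mul_le_of_le_one_right (norm_nonneg _) (hf' k)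

theorem integrable_pow_mul_exp_mul_sin {a : ℝ} (ha : 0 < a) (n : ℕ) (y : ℝ) :
    Integrable fun k : ℝ => k ^ n * Real.exp (-a * k ^ 2) * Real.sin (k * y) :=
  integrable_pow_mul_exp_mul_of_abs_le_one ha n (by fun_prop) fun _ => Real.abs_sin_le_one _

theorem integrable_pow_mul_exp_mul_cos {a : ℝ} (ha : 0 < a) (n : ℕ) (y : ℝ) :
    Integrable fun k : ℝ => k ^ n * Real.exp (-a * k ^ 2) * Real.cos (k * y) :=
  integrable_pow_mul_exp_mul_of_abs_le_one ha n (by fun_prop) fun _ => Real.abs_cos_le_one _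

/-- The half-line sine moments of a Gaussian. -/
noncomputable def gaussSin (a : ℝ) (n : ℕ) (y : ℝ) : ℝ :=
  ∫ k in Set.Ioi (0 : ℝ), k ^ n * Real.exp (-a * k ^ 2) * Real.sin (k * y)

/-- The half-line cosine moments of a Gaussian. -/
noncomputable def gaussCos (a : ℝ) (n : ℕ) (y : ℝ) : ℝ :=
  ∫ k in Set.Ioi (0 : ℝ), k ^ n * Real.exp (-a * k ^ 2) * Real.cos (k * y)

theorem hasDerivAt_exp_neg_mul_sq (a k : ℝ) :
    HasDerivAt (fun k : ℝ => Real.exp (-a * k ^ 2)) (Real.exp (-a * k ^ 2) * (-a * (2 * k))) k := by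
  have := (((hasDerivAt_id k).pow 2).const_mul (-a)).exp
  simpa using this

theorem hasDerivAt_sin_mul (k y : ℝ) :
    HasDerivAt (fun k : ℝ => Real.sin (k * y)) (Real.cos (k * y) * y) k := by
  simpa using ((hasDerivAt_id k).mul_const y).sin

theorem hasDerivAt_cos_mul (k y : ℝ) :
    HasDerivAt (fun k : ℝ => Real.cos (k * y)) (-Real.sin (k * y) * y) k := by
  simpa using ((hasDerivAt_id k).mul_const y).cos

/-- Integrability of both `f` and `f'` forces `f → 0` at infinity, so only the boundary term at `0`
remains. -/
theorem integral_Ioi_of_hasDerivAt_of_integrable {f f' : ℝ → ℝ}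
    (hf : ∀ k, HasDerivAt f (f' k) k) (hi : Integrable f) (hi' : Integrable f') :
    ∫ k in Set.Ioi (0 : ℝ), f' k = -f 0 := by
  rw [integral_Ioi_of_hasDerivAt_of_tendsto (hf 0).continuousAt.continuousWithinAt
    (fun k _ => hf k) hi'.integrableOn (tendsto_zero_of_hasDerivAt_of_integrableOn_Ioi (a := 0)
      (fun k _ => hf k) hi'.integrableOn hi.integrableOn), zero_sub]

theorem gaussCos_one {a : ℝ} (ha : 0 < a) (y : ℝ) :
    2 * a * gaussCos a 1 y + y * gaussSin a 0 y = 1 := by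
  have h1 := integrable_pow_mul_exp_mul_cos ha 1 y
  have h0 := integrable_pow_mul_exp_mul_sin ha 0 y
  have h := integral_Ioi_of_hasDerivAt_of_integrable
    (f := fun k : ℝ => Real.exp (-a * k ^ 2) * Real.cos (k * y))
    (f' := fun k => -(2 * a * (k ^ 1 * Real.exp (-a * k ^ 2) * Real.cos (k * y))
      + y * (k ^ 0 * Real.exp (-a * k ^ 2) * Real.sin (k * y))))
    (fun k => by
      convert! (hasDerivAt_exp_neg_mul_sq a k).mul (hasDerivAt_cos_mul k y) using 1
      ring)
    (by simpa using integrable_pow_mul_exp_mul_cos ha 0 y)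
    ((h1.const_mul _).add (h0.const_mul _)).neg
  rw [integral_neg, integral_add (h1.const_mul _).integrableOn (h0.const_mul _).integrableOn,
    integral_const_mul, integral_const_mul] at h
  have e : Real.exp (-a * 0 ^ 2) * Real.cos (0 * y) = 1 := by simp
  rw [e] at h
  rw [gaussCos, gaussSin]
  linarith

theorem gaussSin_two {a : ℝ} (ha : 0 < a) (y : ℝ) :
    2 * a * gaussSin a 2 y = gaussSin a 0 y + y * gaussCos a 1 y := by
  have h2 := integrable_pow_mul_exp_mul_sin ha 2 y
  have h1 := integrable_pow_mul_exp_mul_cos ha 1 y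
  have h0 := integrable_pow_mul_exp_mul_sin ha 0 y
  have h01 : Integrable fun k : ℝ => k ^ 0 * Real.exp (-a * k ^ 2) * Real.sin (k * y)
      + y * (k ^ 1 * Real.exp (-a * k ^ 2) * Real.cos (k * y)) := h0.add (h1.const_mul _)
  have h := integral_Ioi_of_hasDerivAt_of_integrable
    (f := fun k : ℝ => k ^ 1 * Real.exp (-a * k ^ 2) * Real.sin (k * y))
    (f' := fun k => (k ^ 0 * Real.exp (-a * k ^ 2) * Real.sin (k * y)
      + y * (k ^ 1 * Real.exp (-a * k ^ 2) * Real.cos (k * y)))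
      - 2 * a * (k ^ 2 * Real.exp (-a * k ^ 2) * Real.sin (k * y)))
    (fun k => by
      convert! (((hasDerivAt_id k).pow 1).mul (hasDerivAt_exp_neg_mul_sq a k)).mul
        (hasDerivAt_sin_mul k y) using 1
      simp
      ring)
    (integrable_pow_mul_exp_mul_sin ha 1 y)
    (h01.sub (h2.const_mul _))
  rw [integral_sub h01.integrableOn (h2.const_mul _).integrableOn,
    integral_add h0.integrableOn (h1.const_mul _).integrableOn,
    integral_const_mul, integral_const_mul] at h
  simp only [zero_mul, Real.sin_zero, mul_zero, neg_zero] at h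
  rw [gaussSin, gaussSin, gaussCos]
  linarith

theorem hasDerivAt_gaussSin {a : ℝ} (ha : 0 < a) (y : ℝ) :
    HasDerivAt (gaussSin a 0) (gaussCos a 1 y) y := by
  refine (hasDerivAt_integral_of_dominated_loc_of_deriv_le (μ := volume.restrict (Set.Ioi (0 : ℝ)))
    (F := fun y k => k ^ 0 * Real.exp (-a * k ^ 2) * Real.sin (k * y))
    (F' := fun y k => k ^ 1 * Real.exp (-a * k ^ 2) * Real.cos (k * y))
    (bound := fun k => |k ^ 1 * Real.exp (-a * k ^ 2)|)
    univ_mem (Eventually.of_forall fun z => Continuous.aestronglyMeasurable (by fun_prop))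
    (integrable_pow_mul_exp_mul_sin ha 0 y).integrableOn
    (Continuous.aestronglyMeasurable (by fun_prop))
    (Eventually.of_forall fun k z _ => ?_) (integrable_pow_mul_exp_neg_mul_sq ha 1).abs.integrableOn
    (Eventually.of_forall fun k z _ => ?_)).2
  · rw [Real.norm_eq_abs, abs_mul]
    exact mul_le_of_le_one_right (abs_nonneg _) (Real.abs_cos_le_one _)
  · convert! (((hasDerivAt_id z).const_mul k).sin).const_mul (k ^ 0 * Real.exp (-a * k ^ 2)) using 1
    simp
    ring

/-- By `gaussCos_one`, the sine moment `S` satisfies `2a S' + y S = 1` with `S(0) = 0`. The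
integrating factor `e^(y²/(4a))` solves this, and rescaling `[0, y]` to `[0, 1]` gives the
Dawson-type integral. -/
theorem gaussSin_zero_eq {a : ℝ} (ha : 0 < a) (y : ℝ) :
    gaussSin a 0 y = y / (2 * a) *
      ∫ r in (0 : ℝ)..1, Real.exp (-(y ^ 2 / (4 * a)) * (1 - r ^ 2)) := by
  have hE : ∀ u : ℝ, HasDerivAt (fun u : ℝ => Real.exp (u ^ 2 / (4 * a)))
      (Real.exp (u ^ 2 / (4 * a)) * (u / (2 * a))) u := fun u => by
    convert! (((hasDerivAt_id u).pow 2).div_const (4 * a)).exp using 1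
    simp
    field_simp
    norm_num
  have h := intervalIntegral.integral_eq_sub_of_hasDerivAt (a := (0 : ℝ)) (b := y)
    (f := fun u => Real.exp (u ^ 2 / (4 * a)) * gaussSin a 0 u)
    (f' := fun u => 1 / (2 * a) * Real.exp (u ^ 2 / (4 * a))) (fun u _ => by
      convert! (hE u).mul (hasDerivAt_gaussSin ha u) using 1
      have := gaussCos_one ha u
      field_simp
      linear_combination -this)
    (Continuous.intervalIntegrable (by fun_prop) _ _)
  have h0 : gaussSin a 0 0 = 0 := by simp [gaussSin]
  have hs := intervalIntegral.mul_integral_comp_mul_left (a := 0) (b := 1) (c := y)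
    (f := fun u => 1 / (2 * a) * Real.exp (u ^ 2 / (4 * a)))
  rw [mul_zero, mul_one] at hs
  rw [h0, mul_zero, sub_zero, ← hs, intervalIntegral.integral_const_mul] at h
  have e : ∀ r : ℝ, Real.exp (-(y ^ 2 / (4 * a)) * (1 - r ^ 2)) =
      (Real.exp (y ^ 2 / (4 * a)))⁻¹ * Real.exp ((y * r) ^ 2 / (4 * a)) := fun r => by
    rw [← Real.exp_neg, ← Real.exp_add]
    congr 1
    ring
  simp only [e]
  rw [intervalIntegral.integral_const_mul]
  have hp := Real.exp_pos (y ^ 2 / (4 * a))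
  field_simp
  field_simp at h
  linarith

theorem integral_exp_neg_mul_one_sub_sq (w : ℝ) :
    (1 + 2 * w) * (∫ r in (0 : ℝ)..1, Real.exp (-w * (1 - r ^ 2))) =
      1 + 2 * w * ∫ r in (0 : ℝ)..1, (1 - r ^ 2) * Real.exp (-w * (1 - r ^ 2)) := by
  have h := intervalIntegral.integral_eq_sub_of_hasDerivAt (a := (0 : ℝ)) (b := 1)
    (f := fun r => r * Real.exp (-w * (1 - r ^ 2)))
    (f' := fun r => (1 + 2 * w) * Real.exp (-w * (1 - r ^ 2))
      - 2 * w * ((1 - r ^ 2) * Real.exp (-w * (1 - r ^ 2)))) (fun r _ => by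
      convert! (hasDerivAt_id r).mul ((((hasDerivAt_id r).pow 2).const_sub 1).const_mul (-w)).exp
        using 1
      simp
      ring) (Continuous.intervalIntegrable (by fun_prop) _ _)
  rw [intervalIntegral.integral_sub (Continuous.intervalIntegrable (by fun_prop) _ _)
    (Continuous.intervalIntegrable (by fun_prop) _ _), intervalIntegral.integral_const_mul,
    intervalIntegral.integral_const_mul] at h
  norm_num at h
  simp only [neg_mul]
  linarith

/-- The integral `∫₀¹ (1 - w s) e^{-w s} dr` with `s = 1 - r²`. -/
noncomputable def kummerIntegral (w : ℝ) : ℝ :=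
  ∫ r in (0 : ℝ)..1, (1 - w * (1 - r ^ 2)) * Real.exp (-w * (1 - r ^ 2))

/-- Two integrations by parts reduce the second sine moment to the zeroth. The identity from the
derivative of `r e^(-w(1 - r²))` then absorbs the inhomogeneous term, leaving a multiple of `₁F₁(2;
3/2; -w)`. -/
theorem gaussSin_two_eq {a : ℝ} (ha : 0 < a) (y : ℝ) :
    gaussSin a 2 y = y / (2 * a ^ 2) * kummerIntegral (y ^ 2 / (4 * a)) := by
  have h1 := gaussCos_one ha y
  have h2 := gaussSin_two ha y
  have h3 := gaussSin_zero_eq ha y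
  have h4 := integral_exp_neg_mul_one_sub_sq (y ^ 2 / (4 * a))
  have h5 : kummerIntegral (y ^ 2 / (4 * a)) =
      (∫ r in (0 : ℝ)..1, Real.exp (-(y ^ 2 / (4 * a)) * (1 - r ^ 2))) - y ^ 2 / (4 * a) *
      ∫ r in (0 : ℝ)..1, (1 - r ^ 2) * Real.exp (-(y ^ 2 / (4 * a)) * (1 - r ^ 2)) := by
    rw [← intervalIntegral.integral_const_mul, ← intervalIntegral.integral_sub
      (Continuous.intervalIntegrable (by fun_prop) _ _)
      (Continuous.intervalIntegrable (by fun_prop) _ _), kummerIntegral]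
    exact intervalIntegral.integral_congr fun r _ => by ring
  rw [h5]
  generalize (∫ r in (0 : ℝ)..1, Real.exp (-(y ^ 2 / (4 * a)) * (1 - r ^ 2))) = N at *
  generalize (∫ r in (0 : ℝ)..1, (1 - r ^ 2) * Real.exp (-(y ^ 2 / (4 * a)) * (1 - r ^ 2))) = M at *
  have h6 : gaussCos a 1 y = (1 - y * gaussSin a 0 y) / (2 * a) := by
    field_simp; linarith
  have h7 : gaussSin a 2 y = (gaussSin a 0 y + y * gaussCos a 1 y) / (2 * a) := by
    field_simp; linarith
  rw [h7, h6, h3]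
  field_simp
  field_simp at h4
  linear_combination (-2 * y) * h4

theorem abs_kummerIntegral_le {w : ℝ} (hw : 0 ≤ w) : |kummerIntegral w| ≤ 1 + w := by
  have h := intervalIntegral.norm_integral_le_of_norm_le_const (a := (0 : ℝ)) (b := 1)
    (C := 1 + w) (f := fun r => (1 - w * (1 - r ^ 2)) * Real.exp (-w * (1 - r ^ 2))) fun r hr => ?_
  · simpa [kummerIntegral] using h
  · rw [Set.uIoc_of_le zero_le_one] at hr
    have hs := mul_nonneg hw (one_sub_sq_nonneg ⟨hr.1.le, hr.2⟩)
    have hs' := mul_le_mul_of_nonneg_left (one_sub_sq_le_one r) hw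
    rw [norm_mul, Real.norm_eq_abs, Real.norm_eq_abs, Real.abs_exp]
    exact (mul_le_of_le_one_right (abs_nonneg _) (Real.exp_le_one_iff.2 (by linarith))).trans
      (abs_le.2 ⟨by linarith, by linarith⟩)

/-! ### The multiplier `|k|` on odd Gaussians. -/

theorem integral_eq_integral_Ioi_add_neg {F : ℝ → ℂ} (hF : Integrable F) :
    ∫ x, F x = ∫ x in Set.Ioi (0 : ℝ), (F x + F (-x)) := by
  rw [integral_add hF.integrableOn hF.comp_neg.integrableOn, integral_comp_neg_Ioi, neg_zero,
    add_comm, intervalIntegral.integral_Iic_add_Ioi hF.integrableOn hF.integrableOn]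

theorem integral_fourier_mul_eq_integral_mul_fourier {f g : ℝ → ℂ} (hf : Integrable f)
    (hg : Integrable g) : ∫ ξ, 𝓕 f ξ * g ξ = ∫ x, f x * 𝓕 g x := by
  simpa using! VectorFourier.integral_fourierIntegral_smul_eq_flip (L := innerₗ ℝ)
    Real.continuous_fourierChar continuous_inner hf hg

theorem integrable_abs_mul_fourier (φ : 𝓢(ℝ, ℂ)) :
    Integrable fun ξ : ℝ => ((2 * Real.pi * |ξ| : ℝ) : ℂ) * 𝓕 (φ : ℝ → ℂ) ξ := by
  have h := ((𝓕 φ : 𝓢(ℝ, ℂ)).integrable_pow_mul volume 1).const_mul (2 * Real.pi)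
  have hc : Continuous (𝓕 (φ : ℝ → ℂ)) := (𝓕 φ : 𝓢(ℝ, ℂ)).continuous
  refine h.mono' (Continuous.aestronglyMeasurable (by fun_prop)) (Eventually.of_forall fun ξ => ?_)
  rw [norm_mul, Complex.norm_real, Real.norm_eq_abs,
    abs_of_nonneg (by have := Real.pi_pos; positivity), pow_one, mul_assoc]
  rfl

theorem continuous_sqrtLaplacian (φ : 𝓢(ℝ, ℂ)) : Continuous (sqrtLaplacian φ) := by
  unfold sqrtLaplacian
  have h : Continuous (𝓕 fun ξ : ℝ => ((2 * Real.pi * |ξ| : ℝ) : ℂ) * 𝓕 (φ : ℝ → ℂ) ξ) :=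
    VectorFourier.fourierIntegral_continuous Real.continuous_fourierChar continuous_inner
      (integrable_abs_mul_fourier φ)
  have : (𝓕⁻ fun ξ : ℝ => ((2 * Real.pi * |ξ| : ℝ) : ℂ) * 𝓕 (φ : ℝ → ℂ) ξ) = fun x =>
    (𝓕 fun ξ : ℝ => ((2 * Real.pi * |ξ| : ℝ) : ℂ) * 𝓕 (φ : ℝ → ℂ) ξ) (-x) :=
    funext fun x => Real.fourierInv_eq_fourier_neg _ _
  rw [this]
  exact h.comp continuous_neg

/-- The odd Gaussian `x e^{-t x²}`. -/
noncomputable def oddGaussian (t x : ℝ) : ℂ := ((x * Real.exp (-t * x ^ 2) : ℝ) : ℂ)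

theorem integrable_oddGaussian {t : ℝ} (ht : 0 < t) : Integrable (oddGaussian t) := by
  have := integrable_pow_mul_exp_neg_mul_sq ht 1
  simp only [pow_one] at this
  exact this.ofReal

theorem fourier_gaussian {t : ℝ} (ht : 0 < t) :
    𝓕 (fun x : ℝ => ((Real.exp (-t * x ^ 2) : ℝ) : ℂ)) = fun ξ : ℝ =>
      ((Real.sqrt (Real.pi / t) * Real.exp (-(Real.pi ^ 2 / t) * ξ ^ 2) : ℝ) : ℂ) := by
  have hpi := Real.pi_pos
  have h := fourier_gaussian_pi (b := ((t / Real.pi : ℝ) : ℂ)) (by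
    rw [Complex.ofReal_re]; positivity)
  have e1 : (fun x : ℝ => Complex.exp (-Real.pi * ((t / Real.pi : ℝ) : ℂ) * (x : ℂ) ^ 2)) =
      fun x : ℝ => ((Real.exp (-t * x ^ 2) : ℝ) : ℂ) := by
    ext x
    push_cast
    congr 1
    field_simp
  rw [e1] at h
  rw [h]
  ext ξ
  have e2 : ((t / Real.pi : ℝ) : ℂ) ^ (1 / 2 : ℂ) = ((Real.sqrt (t / Real.pi) : ℝ) : ℂ) := by
    rw [Real.sqrt_eq_rpow, Complex.ofReal_cpow (by positivity)]
    norm_num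
  have e3 : Real.sqrt (Real.pi / t) = 1 / Real.sqrt (t / Real.pi) := by
    rw [one_div, ← Real.sqrt_inv, inv_div]
  rw [e2, e3]
  push_cast
  congr 2
  field_simp

/-- The odd Gaussian is `-1/(2t)` times the derivative of the even one, so its transform follows
from `fourier_gaussian`. -/
theorem fourier_oddGaussian {t : ℝ} (ht : 0 < t) (ξ : ℝ) :
    𝓕 (oddGaussian t) ξ = -Complex.I * ((Real.pi / t * Real.sqrt (Real.pi / t) *
      (ξ * Real.exp (-(Real.pi ^ 2 / t) * ξ ^ 2)) : ℝ) : ℂ) := by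
  have hd : ∀ x : ℝ, HasDerivAt (fun x : ℝ => ((Real.exp (-t * x ^ 2) : ℝ) : ℂ))
      (-(2 * t : ℂ) * oddGaussian t x) x := fun x => by
    convert! (hasDerivAt_exp_neg_mul_sq t x).ofReal_comp using 1
    rw [oddGaussian]
    push_cast
    ring
  have h0 : Integrable fun x : ℝ => ((Real.exp (-t * x ^ 2) : ℝ) : ℂ) := by
    have := integrable_pow_mul_exp_neg_mul_sq ht 0
    simp only [pow_zero, one_mul] at this
    exact this.ofReal
  have hderiv : deriv (fun x : ℝ => ((Real.exp (-t * x ^ 2) : ℝ) : ℂ)) =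
      fun x => -(2 * t : ℂ) * oddGaussian t x := funext fun x => (hd x).deriv
  have h := Real.fourier_deriv h0 (fun x => (hd x).differentiableAt)
    (by rw [hderiv]; exact (integrable_oddGaussian ht).const_mul _)
  rw [hderiv, fourier_gaussian ht] at h
  have h1 := congrFun h ξ
  have h2 : 𝓕 (fun x => -(2 * t : ℂ) * oddGaussian t x) ξ = -(2 * t : ℂ) * 𝓕 (oddGaussian t) ξ := by
    simp only [Real.fourier_real_eq_integral_exp_smul, smul_eq_mul]
    rw [← integral_const_mul]
    congr 1
    ext x
    ring
  rw [h2] at h1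
  have ht' : (t : ℂ) ≠ 0 := by exact_mod_cast ht.ne'
  have h3 : 𝓕 (oddGaussian t) ξ = -(2 * t : ℂ)⁻¹ * (-(2 * t : ℂ) * 𝓕 (oddGaussian t) ξ) := by
    field_simp
  rw [h3, h1, smul_eq_mul]
  push_cast
  field_simp

theorem integrable_abs_mul_fourier_oddGaussian {t : ℝ} (ht : 0 < t) :
    Integrable fun ξ : ℝ => ((2 * Real.pi * |ξ| : ℝ) : ℂ) * 𝓕 (oddGaussian t) ξ := by
  have hpi := Real.pi_pos
  simp only [fourier_oddGaussian ht]
  have ha : 0 < Real.pi ^ 2 / t := by positivity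
  have hs := Real.sqrt_nonneg (Real.pi / t)
  refine ((integrable_pow_mul_exp_neg_mul_sq ha 2).const_mul
    (2 * Real.pi * (Real.pi / t * Real.sqrt (Real.pi / t)))).mono'
    (Continuous.aestronglyMeasurable (by fun_prop)) (Eventually.of_forall fun ξ => le_of_eq ?_)
  rw [norm_mul, norm_mul, norm_neg, Complex.norm_I, one_mul, Complex.norm_real, Complex.norm_real,
    Real.norm_eq_abs, Real.norm_eq_abs, abs_mul _ (ξ * _), abs_mul ξ, Real.abs_exp,
    abs_of_nonneg (show 0 ≤ 2 * Real.pi * |ξ| by positivity),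
    abs_of_nonneg (show 0 ≤ Real.pi / t * Real.sqrt (Real.pi / t) by positivity), ← sq_abs ξ]
  ring

/-- The function `|ξ| ξ e^(-aξ²)` is odd and equals `ξ² e^(-aξ²)` for `ξ > 0`. Folding the integral
at `0` leaves the second sine moment, evaluated at `2πx`. -/
theorem fourier_abs_mul_fourier_oddGaussian {t : ℝ} (ht : 0 < t) (x : ℝ) :
    𝓕 (fun ξ : ℝ => ((2 * Real.pi * |ξ| : ℝ) : ℂ) * 𝓕 (oddGaussian t) ξ) x =
      -((4 / Real.sqrt Real.pi * (Real.sqrt t * x * kummerIntegral (t * x ^ 2)) : ℝ) : ℂ) := by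
  have hpi := Real.pi_pos
  set a := Real.pi ^ 2 / t with ha
  have hapos : 0 < a := by positivity
  set c := 2 * Real.pi * (Real.pi / t * Real.sqrt (Real.pi / t)) with hc
  set F : ℝ → ℂ := fun ξ => Complex.exp (↑(-2 * Real.pi * ξ * x) * Complex.I) •
    (((2 * Real.pi * |ξ| : ℝ) : ℂ) * 𝓕 (oddGaussian t) ξ) with hF
  have hFe : ∀ ξ, F ξ = Complex.exp (↑(-2 * Real.pi * ξ * x) * Complex.I) *
      (-Complex.I * ((c * (|ξ| * ξ * Real.exp (-a * ξ ^ 2)) : ℝ) : ℂ)) := fun ξ => by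
    rw [hF]
    simp only [smul_eq_mul]
    rw [fourier_oddGaussian ht, hc, ha]
    push_cast
    ring
  have hint : Integrable F := by
    have hK := integrable_abs_mul_fourier_oddGaussian ht
    have hexp : Continuous fun ξ : ℝ => Complex.exp (↑(-2 * Real.pi * ξ * x) * Complex.I) := by
      fun_prop
    refine hK.norm.mono' (hexp.aestronglyMeasurable.smul hK.1)
      (Eventually.of_forall fun ξ => ?_)
    rw [hF]
    simp only [norm_smul, Complex.norm_exp_ofReal_mul_I, one_mul, le_refl]
  rw [Real.fourier_real_eq_integral_exp_smul, integral_eq_integral_Ioi_add_neg hint]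
  have hpair : ∀ ξ ∈ Set.Ioi (0 : ℝ), F ξ + F (-ξ) =
      ((-(2 * c) * (ξ ^ 2 * Real.exp (-a * ξ ^ 2) * Real.sin (ξ * (2 * Real.pi * x))) : ℝ) : ℂ) := by
    intro ξ hξ
    have hξ : 0 < ξ := hξ
    rw [hFe, hFe, abs_neg, abs_of_pos hξ, Complex.exp_mul_I, Complex.exp_mul_I,
      ← Complex.ofReal_cos, ← Complex.ofReal_cos, ← Complex.ofReal_sin, ← Complex.ofReal_sin,
      show -2 * Real.pi * ξ * x = -(ξ * (2 * Real.pi * x)) by ring,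
      show -2 * Real.pi * -ξ * x = ξ * (2 * Real.pi * x) by ring, Real.cos_neg, Real.sin_neg,
      neg_sq]
    push_cast
    linear_combination (2 * c * ξ ^ 2 * Complex.exp (-a * ξ ^ 2) *
      Complex.sin (ξ * (2 * Real.pi * x)) : ℂ) * Complex.I_sq
  rw [setIntegral_congr_fun measurableSet_Ioi hpair, integral_complex_ofReal, integral_const_mul,
    ← gaussSin, gaussSin_two_eq hapos, ← Complex.ofReal_neg]
  congr 1
  have e1 : (2 * Real.pi * x) ^ 2 / (4 * a) = t * x ^ 2 := by
    rw [ha]; field_simp; ring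
  have e2 : Real.sqrt (Real.pi / t) = Real.sqrt Real.pi / Real.sqrt t := Real.sqrt_div' _ ht.le
  have e3 : Real.sqrt t ^ 2 = t := Real.sq_sqrt ht.le
  have e4 : Real.sqrt Real.pi ^ 2 = Real.pi := Real.sq_sqrt hpi.le
  have hst : 0 < Real.sqrt t := Real.sqrt_pos.2 ht
  have hsp : 0 < Real.sqrt Real.pi := Real.sqrt_pos.2 hpi
  rw [e1, hc, ha, e2]
  generalize kummerIntegral (t * x ^ 2) = M
  field_simp
  rw [e3, e4]
  ring

theorem integral_oddGaussian_mul_sqrtLaplacian {t : ℝ} (ht : 0 < t) (φ : 𝓢(ℝ, ℂ)) :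
    ∫ x, oddGaussian t x * sqrtLaplacian φ x =
      ∫ x, ((4 / Real.sqrt Real.pi * (Real.sqrt t * x * kummerIntegral (t * x ^ 2)) : ℝ) : ℂ) * φ x := by
  have hg := integrable_oddGaussian ht
  have hH := integrable_abs_mul_fourier φ
  have hodd : ∀ x, oddGaussian t (-x) = -oddGaussian t x := fun x => by
    simp [oddGaussian]
  have hK := integrable_abs_mul_fourier_oddGaussian ht
  calc ∫ x, oddGaussian t x * sqrtLaplacian φ x
      -- Reflection turns the inverse transform in `sqrtLaplacian` into a forward one, at the price
      -- of a sign; the multiplication formula then moves `|ξ|` across to the Gaussian.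
      = ∫ x, oddGaussian t (-x) * sqrtLaplacian φ (-x) := (integral_neg_eq_self _ volume).symm
    _ = -∫ x, oddGaussian t x *
          𝓕 (fun ξ : ℝ => ((2 * Real.pi * |ξ| : ℝ) : ℂ) * 𝓕 (φ : ℝ → ℂ) ξ) x := by
        rw [← integral_neg]
        congr 1
        ext x
        rw [hodd, sqrtLaplacian, Real.fourierInv_eq_fourier_neg, neg_neg, neg_mul]
    _ = -∫ ξ, 𝓕 (φ : ℝ → ℂ) ξ * (((2 * Real.pi * |ξ| : ℝ) : ℂ) * 𝓕 (oddGaussian t) ξ) := by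
        rw [← integral_fourier_mul_eq_integral_mul_fourier hg hH]
        congr 2
        ext ξ
        ring
    _ = _ := by
        rw [integral_fourier_mul_eq_integral_mul_fourier φ.integrable hK, ← integral_neg]
        congr 1
        ext x
        rw [fourier_abs_mul_fourier_oddGaussian ht]
        ring

/-! ### Quadratic decay of `√(-d²/dx²) φ`. -/

/-- This is integration by parts twice: `e^(iαξ) (u' - iαu)` has derivative `e^(iαξ) (u'' + α² u)`.
Because `u 0 = 0`, its boundary value `u'(0)` does not grow with `α`. -/
theorem exists_norm_integral_Ioi_exp_mul_le (u : 𝓢(ℝ, ℂ)) (hu : u 0 = 0) :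
    ∃ K, ∀ α : ℝ, (1 + α ^ 2) *
      ‖∫ ξ in Set.Ioi (0 : ℝ), Complex.exp (↑(α * ξ) * Complex.I) * u ξ‖ ≤ K := by
  set u' := SchwartzMap.derivCLM ℂ ℂ u with hu'
  set u'' := SchwartzMap.derivCLM ℂ ℂ u' with hu''
  have hd : ∀ (w : 𝓢(ℝ, ℂ)) ξ, HasDerivAt w (SchwartzMap.derivCLM ℂ ℂ w ξ) ξ := fun w ξ => by
    rw [SchwartzMap.derivCLM_apply]
    exact w.differentiableAt.hasDerivAt
  have hint : ∀ (w : 𝓢(ℝ, ℂ)) (α : ℝ),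
      Integrable fun ξ : ℝ => Complex.exp (↑(α * ξ) * Complex.I) * w ξ := fun w α => by
    refine w.integrable.norm.mono' (Continuous.aestronglyMeasurable
      (Continuous.mul (by fun_prop) w.continuous)) (Eventually.of_forall fun ξ => ?_)
    rw [norm_mul, Complex.norm_exp_ofReal_mul_I, one_mul]
  have hnorm : ∀ (w : 𝓢(ℝ, ℂ)) (α : ℝ),
      ‖∫ ξ in Set.Ioi (0 : ℝ), Complex.exp (↑(α * ξ) * Complex.I) * w ξ‖ ≤
        ∫ ξ in Set.Ioi (0 : ℝ), ‖w ξ‖ := fun w α => by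
    refine (norm_integral_le_integral_norm _).trans_eq ?_
    simp only [norm_mul, Complex.norm_exp_ofReal_mul_I, one_mul]
  refine ⟨(∫ ξ in Set.Ioi (0 : ℝ), ‖u ξ‖) + (‖u' 0‖ + ∫ ξ in Set.Ioi (0 : ℝ), ‖u'' ξ‖),
    fun α => ?_⟩
  have hw : ∀ ξ, HasDerivAt (fun ξ : ℝ => Complex.exp (↑(α * ξ) * Complex.I) * u' ξ
      - Complex.I * α * (Complex.exp (↑(α * ξ) * Complex.I) * u ξ))
      (Complex.exp (↑(α * ξ) * Complex.I) * u'' ξ +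
        (α : ℂ) ^ 2 * (Complex.exp (↑(α * ξ) * Complex.I) * u ξ)) ξ := fun ξ => by
    have he : HasDerivAt (fun ξ : ℝ => Complex.exp (↑(α * ξ) * Complex.I))
        (Complex.exp (↑(α * ξ) * Complex.I) * (α * Complex.I)) ξ := by
      have h1 : HasDerivAt (fun ξ : ℝ => (↑(α * ξ) : ℂ) * Complex.I) (α * Complex.I) ξ := by
        have h2 : HasDerivAt (fun ξ : ℝ => α * ξ) α ξ := by
          simpa using (hasDerivAt_id ξ).const_mul α
        exact h2.ofReal_comp.mul_const _
      exact h1.cexp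
    convert! (he.mul (hd u' ξ)).sub ((he.mul (hd u ξ)).const_mul (Complex.I * α)) using 1
    rw [← hu', ← hu'']
    linear_combination ((α : ℂ) ^ 2 * Complex.exp (↑(α * ξ) * Complex.I) * u ξ) * Complex.I_sq
  have hi := ((hint u'' α).add ((hint u α).const_mul ((α : ℂ) ^ 2)))
  have hlim := tendsto_zero_of_hasDerivAt_of_integrableOn_Ioi (a := 0) (fun ξ _ => hw ξ)
    hi.integrableOn ((hint u' α).sub ((hint u α).const_mul (Complex.I * α))).integrableOn
  have h := integral_Ioi_of_hasDerivAt_of_tendsto (hw 0).continuousAt.continuousWithinAt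
    (fun ξ _ => hw ξ) hi.integrableOn hlim
  rw [integral_add (hint u'' α).integrableOn ((hint u α).const_mul _).integrableOn,
    integral_const_mul] at h
  simp only [hu, mul_zero, Complex.ofReal_zero, zero_mul, Complex.exp_zero, one_mul, sub_zero,
    zero_sub] at h
  have h2 : α ^ 2 * ‖∫ ξ in Set.Ioi (0 : ℝ), Complex.exp (↑(α * ξ) * Complex.I) * u ξ‖ ≤
      ‖u' 0‖ + ∫ ξ in Set.Ioi (0 : ℝ), ‖u'' ξ‖ := by
    have e : ((α : ℂ) ^ 2) * ∫ ξ in Set.Ioi (0 : ℝ), Complex.exp (↑(α * ξ) * Complex.I) * u ξ =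
        -u' 0 - ∫ ξ in Set.Ioi (0 : ℝ), Complex.exp (↑(α * ξ) * Complex.I) * u'' ξ := by
      rw [← h]; ring
    have e2 := congrArg norm e
    rw [norm_mul, norm_pow, Complex.norm_real, Real.norm_eq_abs, sq_abs] at e2
    rw [e2]
    refine (norm_sub_le _ _).trans ?_
    rw [norm_neg]
    gcongr
    exact hnorm u'' α
  rw [add_mul, one_mul]
  exact add_le_add (hnorm u α) h2

/-- Multiplication of a Schwartz function by the identity function. -/
theorem exists_schwartzMap_mul_id (ψ : 𝓢(ℝ, ℂ)) : ∃ u : 𝓢(ℝ, ℂ), ∀ ξ, u ξ = ξ * ψ ξ := by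
  have hg : Function.HasTemperateGrowth (fun ξ : ℝ => (ξ : ℂ)) :=
    Complex.ofRealCLM.hasTemperateGrowth
  exact ⟨SchwartzMap.smulLeftCLM ℂ (fun ξ : ℝ => (ξ : ℂ)) ψ, fun ξ => by
    rw [SchwartzMap.smulLeftCLM_apply_apply hg, smul_eq_mul]⟩

/-- The symbol `|ξ|` is smooth off `0`, so the integral is cut there. On each half-line the
integrand is `ξ` times a Schwartz function, which vanishes at the cut; the negative half is
reflected, and `φ̂(-ξ)` is the inverse transform of `φ`. -/
theorem exists_norm_sqrtLaplacian_le (φ : 𝓢(ℝ, ℂ)) :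
    ∃ K, 0 ≤ K ∧ ∀ x, ‖sqrtLaplacian φ x‖ ≤ K * (1 + x ^ 2)⁻¹ := by
  have hpi := Real.pi_pos
  obtain ⟨u, hu⟩ := exists_schwartzMap_mul_id (𝓕 φ : 𝓢(ℝ, ℂ))
  obtain ⟨v, hv⟩ := exists_schwartzMap_mul_id (𝓕⁻ φ : 𝓢(ℝ, ℂ))
  obtain ⟨K₁, hK₁⟩ := exists_norm_integral_Ioi_exp_mul_le u (by simp [hu])
  obtain ⟨K₂, hK₂⟩ := exists_norm_integral_Ioi_exp_mul_le v (by simp [hv])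
  have hint : ∀ (w : 𝓢(ℝ, ℂ)) (α : ℝ),
      Integrable fun ξ : ℝ => Complex.exp (↑(α * ξ) * Complex.I) * w ξ := fun w α => by
    refine w.integrable.norm.mono' (Continuous.aestronglyMeasurable
      (Continuous.mul (by fun_prop) w.continuous)) (Eventually.of_forall fun ξ => ?_)
    rw [norm_mul, Complex.norm_exp_ofReal_mul_I, one_mul]
  have hrep : ∀ x, sqrtLaplacian φ x = 2 * Real.pi *
      ((∫ ξ in Set.Ioi (0 : ℝ), Complex.exp (↑(2 * Real.pi * x * ξ) * Complex.I) * u ξ) +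
       ∫ ξ in Set.Ioi (0 : ℝ), Complex.exp (↑(-(2 * Real.pi * x) * ξ) * Complex.I) * v ξ) := by
    intro x
    rw [sqrtLaplacian, Real.fourierInv_eq_fourier_neg, Real.fourier_real_eq_integral_exp_smul,
      integral_eq_integral_Ioi_add_neg, ← integral_add (hint u _).integrableOn
      (hint v _).integrableOn, ← integral_const_mul]
    · refine setIntegral_congr_fun measurableSet_Ioi fun ξ hξ => ?_
      have hξ : 0 < ξ := hξ
      have e : (𝓕⁻ φ : 𝓢(ℝ, ℂ)) ξ = 𝓕 (φ : ℝ → ℂ) (-ξ) := by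
        rw [SchwartzMap.fourierInv_coe, Real.fourierInv_eq_fourier_neg]
      simp only [smul_eq_mul]
      rw [hu, hv, e, abs_neg, abs_of_pos hξ, SchwartzMap.fourier_coe,
        show -2 * Real.pi * ξ * -x = 2 * Real.pi * x * ξ by ring,
        show -2 * Real.pi * -ξ * -x = -(2 * Real.pi * x) * ξ by ring]
      push_cast
      ring
    · have hH := integrable_abs_mul_fourier φ
      have hexp : Continuous fun ξ : ℝ =>
        Complex.exp (↑(-2 * Real.pi * ξ * -x) * Complex.I) := by fun_prop
      refine hH.norm.mono' (hexp.aestronglyMeasurable.smul hH.1) (Eventually.of_forall fun ξ => ?_)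
      simp only [norm_smul, Complex.norm_exp_ofReal_mul_I, one_mul, le_refl]
  have hK : 0 ≤ K₁ + K₂ := add_nonneg ((by positivity : (0 : ℝ) ≤ _).trans (hK₁ 0))
    ((by positivity : (0 : ℝ) ≤ _).trans (hK₂ 0))
  refine ⟨2 * Real.pi * (K₁ + K₂), by positivity, fun x => ?_⟩
  have h1 := hK₁ (2 * Real.pi * x)
  have h2 := hK₂ (-(2 * Real.pi * x))
  rw [← div_eq_mul_inv, le_div_iff₀ (one_add_sq_pos x), hrep, norm_mul, norm_mul,
    Complex.norm_real, Real.norm_eq_abs, abs_of_pos hpi, Complex.norm_ofNat, mul_assoc]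
  refine mul_le_mul_of_nonneg_left ?_ (by positivity)
  set A := ∫ ξ in Set.Ioi (0 : ℝ), Complex.exp (↑(2 * Real.pi * x * ξ) * Complex.I) * u ξ
  set B := ∫ ξ in Set.Ioi (0 : ℝ), Complex.exp (↑(-(2 * Real.pi * x) * ξ) * Complex.I) * v ξ
  have h3 : 1 + x ^ 2 ≤ 1 + (2 * Real.pi * x) ^ 2 := by
    rw [mul_pow]
    have : 1 ≤ (2 * Real.pi) ^ 2 := by nlinarith [Real.pi_gt_three]
    nlinarith [sq_nonneg x]
  rw [neg_sq] at h2
  calc ‖A + B‖ * (1 + x ^ 2) ≤ (‖A‖ + ‖B‖) * (1 + (2 * Real.pi * x) ^ 2) := by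
        gcongr
        exact norm_add_le A B
    _ ≤ K₁ + K₂ := by linarith

theorem integrable_zeroMode_mul_sqrtLaplacian {ν : ℝ} (hν : 0 < ν) (φ : 𝓢(ℝ, ℂ)) :
    Integrable fun x : ℝ => (zeroMode ν x : ℂ) * sqrtLaplacian φ x := by
  obtain ⟨K, hK, h⟩ := exists_norm_sqrtLaplacian_le φ
  -- The bounds `(1 + x²)^(1/2 - ν)` and `(1 + x²)^(-1)` multiply to exponent `-(2ν + 1)/2`,
  -- integrable exactly when `ν > 0`.
  have hi := (integrable_rpow_neg_one_add_norm_sq (E := ℝ) (μ := volume) (r := 2 * ν + 1)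
    (by simp; linarith)).const_mul K
  refine hi.mono' ((Complex.continuous_ofReal.comp (continuous_zeroMode ν)).mul
    (continuous_sqrtLaplacian φ)).aestronglyMeasurable (Eventually.of_forall fun x => ?_)
  have hp := one_add_sq_pos x
  have h1 : |zeroMode ν x| ≤ (1 + x ^ 2) ^ (1 / 2 - ν) := by
    rw [zeroMode, abs_div, abs_of_pos (Real.rpow_pos_of_pos hp ν), Real.rpow_sub hp,
      ← Real.sqrt_eq_rpow]
    gcongr
    exact Real.abs_le_sqrt (by linarith)
  rw [norm_mul, Complex.norm_real, Real.norm_eq_abs, Real.norm_eq_abs, sq_abs]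
  calc |zeroMode ν x| * ‖sqrtLaplacian φ x‖
      ≤ (1 + x ^ 2) ^ (1 / 2 - ν) * (K * (1 + x ^ 2)⁻¹) := by gcongr; exact h x
    _ = K * ((1 + x ^ 2) ^ (1 / 2 - ν) * (1 + x ^ 2) ^ (-1 : ℝ)) := by
        rw [Real.rpow_neg_one]; ring
    _ = _ := by rw [← Real.rpow_add hp]; ring_nf

/-! ### Integration over the Gaussian parameter `t`. -/

theorem continuous_kummerIntegral : Continuous kummerIntegral :=
  intervalIntegral.continuous_parametric_intervalIntegral_of_continuous' (by fun_prop) 0 1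

theorem integral_rpow_mul_exp_neg_mul_exp {a r : ℝ} (ha : 0 < a) (hr : 0 < 1 + r) :
    ∫ t in Set.Ioi (0 : ℝ), t ^ (a - 1) * Real.exp (-t) * Real.exp (-t * r) =
      (1 + r) ^ (-a) * Real.Gamma a := by
  rw [Real.rpow_neg hr.le, ← Real.inv_rpow hr.le, ← one_div,
    ← Real.integral_rpow_mul_exp_neg_mul_Ioi ha hr]
  refine setIntegral_congr_fun measurableSet_Ioi fun t _ => ?_
  rw [mul_assoc, ← Real.exp_add]
  ring_nf

theorem integrableOn_rpow_mul_exp_neg {a : ℝ} (ha : 0 < a) :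
    IntegrableOn (fun t : ℝ => t ^ (a - 1) * Real.exp (-t)) (Set.Ioi 0) := by
  simpa only [mul_comm] using Real.GammaIntegral_convergent ha

theorem integrableOn_rpow_mul_exp_neg_mul_exp {a r : ℝ} (ha : 0 < a) (hr : 0 ≤ r) :
    IntegrableOn (fun t : ℝ => t ^ (a - 1) * Real.exp (-t) * Real.exp (-t * r)) (Set.Ioi 0) := by
  refine (integrableOn_rpow_mul_exp_neg ha).norm.mono'
    (Measurable.aestronglyMeasurable (by fun_prop)) ?_
  filter_upwards [ae_restrict_mem measurableSet_Ioi] with t ht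
  have ht : 0 < t := ht
  rw [norm_mul]
  refine mul_le_of_le_one_right (norm_nonneg _) ?_
  rw [Real.norm_eq_abs, Real.abs_exp, Real.exp_le_one_iff]
  nlinarith [mul_nonneg ht.le hr]

theorem rpow_eq_rpow_sub_one_mul {t : ℝ} (ht : 0 < t) (a : ℝ) : t ^ a = t ^ (a - 1) * t := by
  rw [Real.rpow_sub ht, Real.rpow_one]
  field_simp

theorem integral_rpow_mul_exp_mul_kummer_integrand {b X s : ℝ} (hb : 0 < b) (hXs : 0 ≤ X * s) :
    ∫ t in Set.Ioi (0 : ℝ), t ^ (b - 1) * Real.exp (-t) *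
      ((1 - t * X * s) * Real.exp (-(t * X) * s)) = Real.Gamma b * hyperKernel b (-X * s) := by
  have hp : 0 < 1 + X * s := by linarith
  have h0 := integrableOn_rpow_mul_exp_neg_mul_exp hb hXs
  have h1 := integrableOn_rpow_mul_exp_neg_mul_exp (a := b + 1) (by linarith) hXs
  have e : ∀ t ∈ Set.Ioi (0 : ℝ), t ^ (b - 1) * Real.exp (-t) *
      ((1 - t * X * s) * Real.exp (-(t * X) * s)) =
      t ^ (b - 1) * Real.exp (-t) * Real.exp (-t * (X * s)) -
      X * s * (t ^ (b + 1 - 1) * Real.exp (-t) * Real.exp (-t * (X * s))) := fun t ht => by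
    rw [add_sub_cancel_right, rpow_eq_rpow_sub_one_mul ht b,
      show -(t * X) * s = -t * (X * s) by ring]
    ring
  rw [setIntegral_congr_fun measurableSet_Ioi e, integral_sub h0 (h1.const_mul _),
    integral_const_mul, integral_rpow_mul_exp_neg_mul_exp hb hp,
    integral_rpow_mul_exp_neg_mul_exp (by linarith) hp, Real.Gamma_add_one hb.ne', hyperKernel_neg]
  have e2 : (1 + X * s) ^ (-b) = (1 + X * s) * (1 + X * s) ^ (-(b + 1)) := by
    have := Real.rpow_add hp 1 (-(b + 1))
    rw [Real.rpow_one] at this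
    rw [← this]
    congr 1
    ring
  rw [e2]
  ring

theorem integrableOn_rpow_mul_exp_neg_mul_one_add {b : ℝ} (hb : 0 < b) (X : ℝ) :
    IntegrableOn (fun t : ℝ => t ^ (b - 1) * Real.exp (-t) * (1 + t * X)) (Set.Ioi 0) := by
  have h1 := (integrableOn_rpow_mul_exp_neg hb).add
    ((integrableOn_rpow_mul_exp_neg (show 0 < b + 1 by linarith)).const_mul X)
  refine h1.congr_fun (fun t ht => ?_) measurableSet_Ioi
  simp only [Pi.add_apply]
  rw [add_sub_cancel_right, rpow_eq_rpow_sub_one_mul ht b]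
  ring

/-- The Gamma weight inserts `(b)ₙ` into the series of `₁F₁(2; 3/2; ·)` and so yields `₂F₁(2, b;
3/2; ·)`. The series would not converge for large `X`, so the exchange is made with the `r`-integral
instead, where `|(1 - w s) e^(-w s)| ≤ 1 + w` gives a majorant. -/
theorem integral_rpow_mul_exp_mul_kummerIntegral {b X : ℝ} (hb : 0 < b) (hX : 0 ≤ X) :
    ∫ t in Set.Ioi (0 : ℝ), t ^ (b - 1) * Real.exp (-t) * kummerIntegral (t * X) =
      Real.Gamma b * hyperIntegral b (-X) := by
  have hm : Measurable (Function.uncurry fun t r : ℝ => t ^ (b - 1) * Real.exp (-t) *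
      ((1 - t * X * (1 - r ^ 2)) * Real.exp (-(t * X) * (1 - r ^ 2)))) := by
    unfold Function.uncurry
    fun_prop
  have hint : Integrable (Function.uncurry fun t r : ℝ => t ^ (b - 1) * Real.exp (-t) *
      ((1 - t * X * (1 - r ^ 2)) * Real.exp (-(t * X) * (1 - r ^ 2))))
      ((volume.restrict (Set.Ioi (0 : ℝ))).prod (volume.restrict (Set.Ioc (0 : ℝ) 1))) := by
    have h1 : Integrable (fun _ : ℝ => (1 : ℝ)) (volume.restrict (Set.Ioc (0 : ℝ) 1)) :=
      integrable_const 1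
    refine ((integrableOn_rpow_mul_exp_neg_mul_one_add hb X).integrable.mul_prod h1).mono'
      hm.aestronglyMeasurable ?_
    rw [Measure.prod_restrict]
    filter_upwards [ae_restrict_mem (measurableSet_Ioi.prod measurableSet_Ioc)] with p hp
    obtain ⟨t, r⟩ := p
    have ht : 0 < t := hp.1
    have hr : r ∈ Set.Icc (0 : ℝ) 1 := ⟨hp.2.1.le, hp.2.2⟩
    have htX := mul_nonneg ht.le hX
    have hs := mul_nonneg htX (one_sub_sq_nonneg hr)
    have hs' := mul_le_mul_of_nonneg_left (one_sub_sq_le_one r) htX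
    have hpos : 0 ≤ t ^ (b - 1) * Real.exp (-t) := by positivity
    rw [Function.uncurry_apply_pair, norm_mul, Real.norm_of_nonneg hpos, mul_one]
    refine mul_le_mul_of_nonneg_left ?_ hpos
    rw [norm_mul, Real.norm_eq_abs, Real.norm_eq_abs, Real.abs_exp]
    exact (mul_le_of_le_one_right (abs_nonneg _) (Real.exp_le_one_iff.2 (by linarith))).trans
      (abs_le.2 ⟨by linarith, by linarith⟩)
  calc _ = ∫ t in Set.Ioi (0 : ℝ), ∫ r in Set.Ioc (0 : ℝ) 1, t ^ (b - 1) * Real.exp (-t) *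
      ((1 - t * X * (1 - r ^ 2)) * Real.exp (-(t * X) * (1 - r ^ 2))) := by
        refine setIntegral_congr_fun measurableSet_Ioi fun t _ => ?_
        simp only [kummerIntegral]
        rw [integral_const_mul, intervalIntegral.integral_of_le zero_le_one]
    _ = ∫ r in Set.Ioc (0 : ℝ) 1, ∫ t in Set.Ioi (0 : ℝ), t ^ (b - 1) * Real.exp (-t) *
      ((1 - t * X * (1 - r ^ 2)) * Real.exp (-(t * X) * (1 - r ^ 2))) :=
        integral_integral_swap hint
    _ = ∫ r in Set.Ioc (0 : ℝ) 1, Real.Gamma b * hyperKernel b (-X * (1 - r ^ 2)) :=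
        setIntegral_congr_fun measurableSet_Ioc fun r hr =>
          integral_rpow_mul_exp_mul_kummer_integrand hb
            (mul_nonneg hX (one_sub_sq_nonneg ⟨hr.1.le, hr.2⟩))
    _ = _ := by
        rw [integral_const_mul, hyperIntegral, intervalIntegral.integral_of_le zero_le_one]

theorem zeroMode_eq_integral {ν : ℝ} (hν : 0 < ν) (x : ℝ) :
    ∫ t in Set.Ioi (0 : ℝ), ((t ^ (ν - 1) * Real.exp (-t) : ℝ) : ℂ) * oddGaussian t x =
      ((Real.Gamma ν * zeroMode ν x : ℝ) : ℂ) := by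
  have h := integral_rpow_mul_exp_neg_mul_exp hν (one_add_sq_pos x)
  have e : ∀ t : ℝ, ((t ^ (ν - 1) * Real.exp (-t) : ℝ) : ℂ) * oddGaussian t x =
      ((x * (t ^ (ν - 1) * Real.exp (-t) * Real.exp (-t * x ^ 2)) : ℝ) : ℂ) := fun t => by
    rw [oddGaussian]
    push_cast
    ring
  simp only [e]
  rw [integral_complex_ofReal, integral_const_mul, h, zeroMode, Real.rpow_neg (one_add_sq_pos x).le]
  congr 1
  field_simp

theorem norm_oddGaussian (t x : ℝ) : ‖oddGaussian t x‖ = |x| * Real.exp (-t * x ^ 2) := by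
  rw [oddGaussian, Complex.norm_real, norm_mul, Real.norm_eq_abs, Real.norm_eq_abs, Real.abs_exp]

theorem integrable_prod_oddGaussian_mul_sqrtLaplacian {ν : ℝ} (hν : 0 < ν) (φ : 𝓢(ℝ, ℂ)) :
    Integrable (Function.uncurry fun t x : ℝ => ((t ^ (ν - 1) * Real.exp (-t) : ℝ) : ℂ) *
      oddGaussian t x * sqrtLaplacian φ x) ((volume.restrict (Set.Ioi (0 : ℝ))).prod volume) := by
  have hm : Measurable (Function.uncurry fun t x : ℝ => ((t ^ (ν - 1) * Real.exp (-t) : ℝ) : ℂ) *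
      oddGaussian t x * sqrtLaplacian φ x) := by
    have := (continuous_sqrtLaplacian φ).measurable
    unfold Function.uncurry oddGaussian
    fun_prop
  have hnorm : ∀ x, ∀ t ∈ Set.Ioi (0 : ℝ), ‖((t ^ (ν - 1) * Real.exp (-t) : ℝ) : ℂ) *
      oddGaussian t x * sqrtLaplacian φ x‖ =
      |x| * ‖sqrtLaplacian φ x‖ * (t ^ (ν - 1) * Real.exp (-t) * Real.exp (-t * x ^ 2)) :=
    fun x t ht => by
      have ht : 0 < t := ht
      rw [norm_mul, norm_mul, norm_oddGaussian, Complex.norm_real,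
        Real.norm_of_nonneg (by positivity)]
      ring
  rw [integrable_prod_iff' hm.aestronglyMeasurable]
  refine ⟨Eventually.of_forall fun x => ?_, ?_⟩
  · have h := ((integrableOn_rpow_mul_exp_neg_mul_exp hν (sq_nonneg x)).const_mul
      (|x| * ‖sqrtLaplacian φ x‖))
    refine h.mono' (hm.comp (by fun_prop : Measurable fun t : ℝ => (t, x))).aestronglyMeasurable ?_
    filter_upwards [ae_restrict_mem measurableSet_Ioi] with t ht
    exact (hnorm x t ht).le
  -- The weight is positive and the odd Gaussian has constant sign in `t`, so the `t`-integral of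
  -- the norms is exactly `Γ(ν) ‖v_ν √(-d²/dx²) φ‖`.
  · refine ((integrable_zeroMode_mul_sqrtLaplacian hν φ).norm.const_mul (Real.Gamma ν)).congr
      (Eventually.of_forall fun x => ?_)
    simp only [Function.uncurry_apply_pair]
    rw [setIntegral_congr_fun measurableSet_Ioi (hnorm x), integral_const_mul,
      integral_rpow_mul_exp_neg_mul_exp hν (one_add_sq_pos x), norm_mul, Complex.norm_real,
      Real.norm_eq_abs, zeroMode, abs_div,
      abs_of_pos (Real.rpow_pos_of_pos (one_add_sq_pos x) ν), Real.rpow_neg (one_add_sq_pos x).le]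
    ring

theorem integrable_prod_kummerIntegral_mul {ν : ℝ} (hν : 0 < ν) (φ : 𝓢(ℝ, ℂ)) :
    Integrable (Function.uncurry fun t x : ℝ => ((t ^ (ν - 1) * Real.exp (-t) : ℝ) : ℂ) *
      (((4 / Real.sqrt Real.pi * (Real.sqrt t * x * kummerIntegral (t * x ^ 2)) : ℝ) : ℂ) * φ x))
      ((volume.restrict (Set.Ioi (0 : ℝ))).prod volume) := by
  have hm : Measurable (Function.uncurry fun t x : ℝ => ((t ^ (ν - 1) * Real.exp (-t) : ℝ) : ℂ) *
      (((4 / Real.sqrt Real.pi * (Real.sqrt t * x * kummerIntegral (t * x ^ 2)) : ℝ) : ℂ) *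
        φ x)) := by
    have := φ.continuous.measurable
    have := continuous_kummerIntegral.measurable
    unfold Function.uncurry
    fun_prop
  have h1 := integrableOn_rpow_mul_exp_neg_mul_one_add (show 0 < ν + 1 / 2 by linarith) 1
  have h2 : Integrable fun x : ℝ => 4 / Real.sqrt Real.pi *
      (‖x‖ ^ 1 * ‖φ x‖ + ‖x‖ ^ 3 * ‖φ x‖) :=
    ((φ.integrable_pow_mul volume 1).add (φ.integrable_pow_mul volume 3)).const_mul _
  refine (h1.integrable.mul_prod h2).mono' hm.aestronglyMeasurable ?_
  have hae : ∀ᵐ p : ℝ × ℝ ∂((volume.restrict (Set.Ioi (0 : ℝ))).prod volume), 0 < p.1 :=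
    Measure.quasiMeasurePreserving_fst.ae (ae_restrict_mem measurableSet_Ioi)
  filter_upwards [hae] with p hp
  obtain ⟨t, x⟩ := p
  have ht : 0 < t := hp
  have hk := abs_kummerIntegral_le (mul_nonneg ht.le (sq_nonneg x))
  have hsplit : t ^ (ν + 1 / 2 - 1) = t ^ (ν - 1) * Real.sqrt t := by
    rw [Real.sqrt_eq_rpow, ← Real.rpow_add ht]
    ring_nf
  have hpi := Real.pi_pos
  have hsq := Real.sqrt_nonneg t
  have hs' := Real.sqrt_nonneg Real.pi
  rw [Function.uncurry_apply_pair, norm_mul, norm_mul, Complex.norm_real, Complex.norm_real,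
    Real.norm_of_nonneg (show 0 ≤ t ^ (ν - 1) * Real.exp (-t) by positivity), norm_mul, norm_mul,
    norm_mul, Real.norm_of_nonneg (show 0 ≤ 4 / Real.sqrt Real.pi by positivity),
    Real.norm_of_nonneg hsq, hsplit, Real.norm_eq_abs, Real.norm_eq_abs]
  dsimp only
  have hb : |kummerIntegral (t * x ^ 2)| ≤ (1 + t) * (1 + |x| ^ 2) := by
    rw [sq_abs]
    nlinarith [sq_nonneg x]
  calc _ = t ^ (ν - 1) * Real.exp (-t) * (4 / Real.sqrt Real.pi) * Real.sqrt t * |x| * ‖φ x‖ *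
        |kummerIntegral (t * x ^ 2)| := by ring
    _ ≤ t ^ (ν - 1) * Real.exp (-t) * (4 / Real.sqrt Real.pi) * Real.sqrt t * |x| * ‖φ x‖ *
        ((1 + t) * (1 + |x| ^ 2)) := by gcongr
    _ = _ := by ring

theorem isDistributionalZeroSolution_zeroMode {ν : ℝ} (hν : 0 < ν) (hν' : ν ≠ 1 / 2) :
    IsDistributionalZeroSolution (potential ν) (zeroMode ν) := by
  intro φ
  refine ⟨integrable_zeroMode_mul_sqrtLaplacian hν φ,
    integrable_potential_mul_zeroMode_mul hν hν' φ, ?_⟩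
  have hG := Real.Gamma_pos_of_pos hν
  have hGc : (Real.Gamma ν : ℂ) ≠ 0 := by exact_mod_cast hG.ne'
  have key : (Real.Gamma ν : ℂ) * ∫ x : ℝ, (zeroMode ν x : ℂ) * sqrtLaplacian φ x =
      -((Real.Gamma ν : ℂ) * ∫ x : ℝ, ((potential ν x * zeroMode ν x : ℝ) : ℂ) * φ x) := by
    calc _ = ∫ x : ℝ, ∫ t in Set.Ioi (0 : ℝ), ((t ^ (ν - 1) * Real.exp (-t) : ℝ) : ℂ) *
          oddGaussian t x * sqrtLaplacian φ x := by
          rw [← integral_const_mul]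
          congr 1
          ext x
          rw [integral_mul_const, zeroMode_eq_integral hν]
          push_cast
          ring
      _ = ∫ t in Set.Ioi (0 : ℝ), ∫ x : ℝ, ((t ^ (ν - 1) * Real.exp (-t) : ℝ) : ℂ) *
          oddGaussian t x * sqrtLaplacian φ x :=
          (integral_integral_swap (integrable_prod_oddGaussian_mul_sqrtLaplacian hν φ)).symm
      _ = ∫ t in Set.Ioi (0 : ℝ), ∫ x : ℝ, ((t ^ (ν - 1) * Real.exp (-t) : ℝ) : ℂ) *
          (((4 / Real.sqrt Real.pi * (Real.sqrt t * x * kummerIntegral (t * x ^ 2)) : ℝ) : ℂ) *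
            φ x) := by
          refine setIntegral_congr_fun measurableSet_Ioi fun t ht => ?_
          simp only [mul_assoc _ (oddGaussian t _)]
          rw [integral_const_mul, integral_const_mul, integral_oddGaussian_mul_sqrtLaplacian ht]
      _ = ∫ x : ℝ, ∫ t in Set.Ioi (0 : ℝ), ((t ^ (ν - 1) * Real.exp (-t) : ℝ) : ℂ) *
          (((4 / Real.sqrt Real.pi * (Real.sqrt t * x * kummerIntegral (t * x ^ 2)) : ℝ) : ℂ) *
            φ x) := integral_integral_swap (integrable_prod_kummerIntegral_mul hν φ)
      _ = _ := by
          rw [← integral_const_mul, ← integral_neg]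
          congr 1
          ext x
          have h := integral_rpow_mul_exp_mul_kummerIntegral (b := ν + 1 / 2) (by linarith)
            (sq_nonneg x)
          have e : ∀ t ∈ Set.Ioi (0 : ℝ), ((t ^ (ν - 1) * Real.exp (-t) : ℝ) : ℂ) *
              (((4 / Real.sqrt Real.pi * (Real.sqrt t * x * kummerIntegral (t * x ^ 2)) : ℝ) : ℂ) *
              φ x) = ((4 / Real.sqrt Real.pi * x * (t ^ (ν + 1 / 2 - 1) * Real.exp (-t) *
              kummerIntegral (t * x ^ 2)) : ℝ) : ℂ) * φ x := fun t ht => by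
            -- The `√t` produced by `|k|` is what shifts the Gamma parameter to `ν + 1/2`.
            have hsplit : t ^ (ν + 1 / 2 - 1) = t ^ (ν - 1) * Real.sqrt t := by
              rw [Real.sqrt_eq_rpow, ← Real.rpow_add ht]
              ring_nf
            rw [hsplit]
            push_cast
            ring
          rw [setIntegral_congr_fun measurableSet_Ioi e, integral_mul_const,
            integral_complex_ofReal, integral_const_mul, h, potential_mul_zeroMode hν hν',
            potentialConst, ← mul_assoc (Real.Gamma ν : ℂ), ← Complex.ofReal_mul, ← neg_mul, ← Complex.ofReal_neg]
          congr 2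
          have := Real.sqrt_pos.2 Real.pi_pos
          field_simp
  have := mul_left_cancel₀ hGc (key.trans (mul_neg _ _).symm)
  rw [this, neg_add_cancel]

/-! ### From the distributional equation to `L²`. -/

theorem integral_mul_Lp_fourier (Ψ : 𝓢(ℝ, ℂ)) (f : Lp ℂ 2 (volume : Measure ℝ)) :
    ∫ ξ, Ψ ξ * (𝓕 f : Lp ℂ 2 (volume : Measure ℝ)) ξ = ∫ x, (𝓕 Ψ : 𝓢(ℝ, ℂ)) x * f x := by
  have h := congrArg (fun T => T Ψ) (Lp.fourier_toTemperedDistribution_eq f)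
  simpa [Lp.toTemperedDistribution_apply] using! h.symm

/-- Evenness of `|ξ|` lets the reflections from the double transform cancel. The hypothesis asks
that `2π|ξ| Ψ` be Schwartz again, which holds when `Ψ` vanishes near `0`. -/
theorem sqrtLaplacian_fourier (Ψ H : 𝓢(ℝ, ℂ))
    (hH : ∀ ξ, H ξ = ((2 * Real.pi * |ξ| : ℝ) : ℂ) * Ψ ξ) (x : ℝ) :
    sqrtLaplacian (𝓕 Ψ) x = (𝓕 H : 𝓢(ℝ, ℂ)) x := by
  have h1 : ∀ ξ, 𝓕 ((𝓕 Ψ : 𝓢(ℝ, ℂ)) : ℝ → ℂ) ξ = Ψ (-ξ) := fun ξ => by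
    have h2 : 𝓕⁻ ((𝓕 Ψ : 𝓢(ℝ, ℂ)) : ℝ → ℂ) (-ξ) = Ψ (-ξ) := by
      rw [← SchwartzMap.fourierInv_coe, FourierTransform.fourierInv_fourier_eq]
    rw [← h2, Real.fourierInv_eq_fourier_neg, neg_neg]
  rw [sqrtLaplacian, Real.fourierInv_eq_fourier_comp_neg, SchwartzMap.fourier_coe H]
  refine congrFun (congrArg 𝓕 (funext fun ξ => ?_)) x
  rw [h1, neg_neg, abs_neg, hH]

theorem contDiff_abs_mul_of_tsupport {ψ : ℝ → ℂ} (hψ : ContDiff ℝ (⊤ : ℕ∞) ψ)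
    (h0 : tsupport ψ ⊆ {0}ᶜ) :
    ContDiff ℝ (⊤ : ℕ∞) fun ξ : ℝ => ((2 * Real.pi * |ξ| : ℝ) : ℂ) * ψ ξ := by
  refine contDiff_iff_contDiffAt.2 fun ξ => ?_
  rcases eq_or_ne ξ 0 with rfl | hξ0
  · have h1 : ψ =ᶠ[𝓝 0] 0 := notMem_tsupport_iff_eventuallyEq.1 fun h => h0 h rfl
    refine (contDiffAt_const (c := (0 : ℂ))).congr_of_eventuallyEq ?_
    filter_upwards [h1] with x hx
    rw [hx, Pi.zero_apply, mul_zero]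
  · have h1 : ContDiffAt ℝ (⊤ : ℕ∞) (fun ξ : ℝ => 2 * Real.pi * |ξ|) ξ :=
      contDiffAt_const.mul (contDiffAt_abs hξ0)
    exact (Complex.ofRealCLM.contDiff.contDiffAt.comp ξ h1).mul hψ.contDiffAt

/-- The hypothesis is tested on `φ = 𝓕 Ψ` with `Ψ` smooth and compactly supported in `{0}ᶜ`, so that
the corner of `|ξ|` does no harm. This determines `𝓕 g` almost everywhere off the null set `{0}`. -/
theorem fourier_ae_eq_abs_mul_fourier {f g : Lp ℂ 2 (volume : Measure ℝ)}
    (h : ∀ φ : 𝓢(ℝ, ℂ), ∫ x, sqrtLaplacian φ x * f x = ∫ x, φ x * g x) :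
    ∀ᵐ ξ : ℝ, (𝓕 g : Lp ℂ 2 (volume : Measure ℝ)) ξ =
      ((2 * Real.pi * |ξ| : ℝ) : ℂ) * (𝓕 f : Lp ℂ 2 (volume : Measure ℝ)) ξ := by
  have hlg : LocallyIntegrable (𝓕 g : Lp ℂ 2 (volume : Measure ℝ)) volume :=
    (Lp.memLp _).locallyIntegrable one_le_two
  have hlf : LocallyIntegrable (fun ξ : ℝ => ((2 * Real.pi * |ξ| : ℝ) : ℂ) *
      (𝓕 f : Lp ℂ 2 (volume : Measure ℝ)) ξ) volume := by
    have h1 : LocallyIntegrable (𝓕 f : Lp ℂ 2 (volume : Measure ℝ)) volume :=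
      (Lp.memLp _).locallyIntegrable one_le_two
    rw [← locallyIntegrableOn_univ] at h1 ⊢
    exact h1.continuousOn_mul (Continuous.continuousOn (by fun_prop)) isOpen_univ.isLocallyClosed
  have hU : IsOpen ({0}ᶜ : Set ℝ) := isOpen_compl_singleton
  have key := hU.ae_eq_zero_of_integral_contDiff_smul_eq_zero (μ := volume)
    ((hlg.sub hlf).locallyIntegrableOn _) fun ψ hψ hψc hψ0 => by
    have hψ' : ContDiff ℝ (⊤ : ℕ∞) fun ξ => (ψ ξ : ℂ) := Complex.ofRealCLM.contDiff.comp hψ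
    have hsupp : HasCompactSupport fun ξ => (ψ ξ : ℂ) :=
      hψc.comp_left (g := fun y : ℝ => (y : ℂ)) Complex.ofReal_zero
    have hts : tsupport (fun ξ => (ψ ξ : ℂ)) ⊆ {0}ᶜ :=
      (closure_mono fun ξ hξ => by simpa using hξ).trans hψ0
    have hsuppH : HasCompactSupport fun ξ : ℝ => ((2 * Real.pi * |ξ| : ℝ) : ℂ) * ψ ξ :=
      hsupp.mul_left
    set Ψ : 𝓢(ℝ, ℂ) := hsupp.toSchwartzMap hψ' with hΨ
    set H : 𝓢(ℝ, ℂ) := hsuppH.toSchwartzMap (contDiff_abs_mul_of_tsupport hψ' hts) with hH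
    have e1 : ∫ ξ, Ψ ξ * (𝓕 g : Lp ℂ 2 (volume : Measure ℝ)) ξ =
        ∫ ξ, H ξ * (𝓕 f : Lp ℂ 2 (volume : Measure ℝ)) ξ := by
      rw [integral_mul_Lp_fourier, integral_mul_Lp_fourier, ← h]
      simp only [sqrtLaplacian_fourier Ψ H fun ξ => rfl]
    have i1 := hlg.integrable_smul_left_of_hasCompactSupport hψ.continuous hψc
    have i2 := hlf.integrable_smul_left_of_hasCompactSupport hψ.continuous hψc
    simp only [Pi.sub_apply, smul_sub]
    rw [integral_sub i1 i2, sub_eq_zero]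
    refine Eq.trans ?_ (e1.trans ?_)
    · exact integral_congr_ae (Eventually.of_forall fun ξ => Complex.real_smul)
    · refine integral_congr_ae (Eventually.of_forall fun ξ => ?_)
      dsimp only
      rw [Complex.real_smul, ← mul_assoc, mul_comm (ψ ξ : ℂ)]
      rfl
  have h0 : ∀ᵐ ξ : ℝ, ξ ≠ 0 := by simp [ae_iff]
  filter_upwards [key, h0] with ξ h1 h2
  exact sub_eq_zero.1 (h1 h2)

theorem isZeroEigenfunction_zeroMode {ν : ℝ} (hν : 3 / 4 < ν) :
    IsZeroEigenfunction (potential ν) (zeroMode ν) := by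
  have hf : MemLp (fun x => (zeroMode ν x : ℂ)) 2 volume := (memLp_two_zeroMode hν).ofReal
  have hg : MemLp (fun x => -((potential ν x * zeroMode ν x : ℝ) : ℂ)) 2 volume :=
    (memLp_two_potential_mul_zeroMode (by linarith)).ofReal.neg
  refine ⟨hf.toLp _, hg.toLp _, fun h0 => ?_, hf.coeFn_toLp, ?_, ?_⟩
  · have h1 : (fun x => (zeroMode ν x : ℂ)) =ᵐ[volume] fun _ => 0 :=
      (hf.coeFn_toLp.symm.trans (by rw [h0])).trans (Lp.coeFn_zero _ _ _)
    -- A continuous function that vanishes almost everywhere vanishes identically, but `v_ν(1) > 0`.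
    have h2 := (Complex.continuous_ofReal.comp (continuous_zeroMode ν)).ae_eq_iff_eq volume
      continuous_const |>.1 h1
    have h3 := congrFun h2 1
    simp only [Function.comp_apply, Complex.ofReal_eq_zero, zeroMode] at h3
    exact (div_pos one_pos (Real.rpow_pos_of_pos (one_add_sq_pos 1) ν)).ne' h3
  · refine fourier_ae_eq_abs_mul_fourier fun φ => ?_
    obtain ⟨-, -, h⟩ := isDistributionalZeroSolution_zeroMode (ν := ν) (by linarith)
      (by linarith) φ
    calc _ = ∫ x : ℝ, (zeroMode ν x : ℂ) * sqrtLaplacian φ x := by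
          refine integral_congr_ae ?_
          filter_upwards [hf.coeFn_toLp] with x hx
          rw [hx, mul_comm]
      _ = -∫ x : ℝ, ((potential ν x * zeroMode ν x : ℝ) : ℂ) * φ x := eq_neg_of_add_eq_zero_left h
      _ = _ := by
          rw [← integral_neg]
          refine integral_congr_ae ?_
          filter_upwards [hg.coeFn_toLp] with x hx
          rw [hx]
          ring
  · filter_upwards [hg.coeFn_toLp] with x hx
    rw [hx, neg_add_cancel]

theorem theorem5 (ν : ℝ) (hν : 0 < ν) (hν' : ν ≠ 1 / 2) :
    IsDistributionalZeroSolution (potential ν) (zeroMode ν) ∧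
    Function.Odd (zeroMode ν) ∧
    (3 / 4 < ν → IsZeroEigenfunction (potential ν) (zeroMode ν)) ∧
    (1 / 2 < ν → ν ≤ 3 / 4 → IsZeroResonance (potential ν) (zeroMode ν)) ∧
    (1 / 2 < ν → ν < 3 / 2 → ν ≠ 1 →
      potential ν =O[cocompact ℝ] fun x : ℝ => 1 / |x|) ∧
    (ν = 1 → potential ν =O[cocompact ℝ] fun x : ℝ => 1 / |x| ^ 2) ∧
    (ν = 3 / 2 → potential ν =O[cocompact ℝ] fun x : ℝ => Real.log |x| / |x|) ∧
    (3 / 2 < ν → ν < 2 →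
      potential ν =O[cocompact ℝ] fun x : ℝ => 1 / |x| ^ (4 - 2 * ν)) := by
  refine ⟨isDistributionalZeroSolution_zeroMode hν hν', odd_zeroMode ν,
    isZeroEigenfunction_zeroMode, fun h1 h2 => ⟨isDistributionalZeroSolution_zeroMode hν hν',
      tendsto_zeroMode_cocompact h1, not_memLp_two_zeroMode h2⟩,
    fun h1 h2 _ => potential_isBigO_of_lt h1 h2, ?_, ?_, fun h _ => potential_isBigO_of_gt h⟩
  · rintro rfl
    exact potential_one_isBigO
  · rintro rfl
    exact potential_three_halves_isBigO
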